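/- Let $p$ be a prime number. For a ring $B$ of characteristic $p$ let $F^e_*B$ denote the ring $B$, regarded as a $B$-algebra through $b\mapsto b^{p^e}$; when $B$ is a domain this algebra is written $B^{1/p^e}$. The ring $B$ is $F$-finite if $F^1_*B$ is a finite $B$-module, and $S_{\mathrm{red}}$ denotes the quotient of a ring $S$ by its nilradical. A ring is equidimensional if all irreducible components of its spectrum have the same dimension. Let $\varphi\colon A\to R$ be a ring homomorphism of finite type between $F$-finite Noetherian rings of characteristic $p$. Assume that the regular locus of $A$ is non-empty and that the generic fibers $R\otimes_A\kappa(\mathfrak p)$, $\mathfrak p$ a minimal prime of $A$, are equidimensional. Assume moreover that $R\otimes_A\kappa(\mathfrak p)\neq 0$ for at least one minimal prime $\mathfrak p$ of $A$ at which $A$ is regular (this is automatic if $\varphi$ is injective). Then there are $f\in A$ and an integer $e_0>0$ with the following properties. 1. $A_f$ is a regular domain, and $(R\otimes_A A_f^{1/p^{e_0}})_{\mathrm{red}}$ is faithfully flat over $A_f^{1/p^{e_0}}$. 2. The generic fiber of $A_f^{1/p^{e_0}}\to (R\otimes_A A_f^{1/p^{e_0}})_{\mathrm{red}}$ is geometrically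 reduced over $\operatorname{Frac}(A_f^{1/p^{e_0}})$. Likewise all generic fibers (the fibers over the minimal primes) of $F^{e_0}_*A\to (R\otimes_A F^{e_0}_*A)_{\mathrm{red}}$ are geometrically reduced. 3. $F^{e_0}_*(R_f)$ is an $(R\otimes_A A_f^{1/p^{e_0}})_{\mathrm{red}}$-algebra: the relative Frobenius $R\otimes_A A_f^{1/p^{e_0}}\to F^{e_0}_*(R_f)$, which sends $r\otimes a^{1/p^{e_0}}$ to $F^{e_0}_*(r^{p^{e_0}}\varphi_f(a))$, factors through $(R\otimes_A A_f^{1/p^{e_0}})_{\mathrm{red}}$. -/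

import Mathlib

open scoped TensorProduct

/-- `FrobeniusPushforward p e B` is the ring `F^e_* B`: it is `B` as a ring, but it is an algebra
over `B` (and over any `A` such that `B` is an `A`-algebra) through the `e`-th iterate of the
Frobenius, `b ↦ b ^ p ^ e`. If `B` is reduced, it is the `B`-algebra `B^{1/p^e}`, an element `b`
of the underlying ring standing for its `p^e`-th root. -/
def FrobeniusPushforward (_p _e : ℕ) (B : Type*) : Type _ := B

namespace FrobeniusPushforward

instance (p e : ℕ) (B : Type*) [CommRing B] : CommRing (FrobeniusPushforward p e B) :=
  inferInstanceAs (CommRing B)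

/-- The identity map `B → F^e_* B` of the underlying rings (it is not `B`-linear). -/
def of (p e : ℕ) (B : Type*) [CommRing B] : B ≃+* FrobeniusPushforward p e B :=
  RingEquiv.refl B

instance (p e : ℕ) (B : Type*) [CommRing B] [IsDomain B] :
    IsDomain (FrobeniusPushforward p e B) :=
  inferInstanceAs (IsDomain B)

/-- The structure map `A → F^e_* B`, `a ↦ (a · 1) ^ p ^ e`. -/
instance (p e : ℕ) [Fact p.Prime] (A B : Type*) [CommRing A] [CommRing B] [CharP B p]
    [Algebra A B] : Algebra A (FrobeniusPushforward p e B) :=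
  (((of p e B).toRingHom.comp (iterateFrobenius B p e)).comp (algebraMap A B)).toAlgebra

theorem algebraMap_apply (p e : ℕ) [Fact p.Prime] (A B : Type*) [CommRing A] [CommRing B]
    [CharP B p] [Algebra A B] (a : A) :
    algebraMap A (FrobeniusPushforward p e B) a = of p e B (algebraMap A B a ^ p ^ e) :=
  rfl

end FrobeniusPushforward

/-- A ring of prime characteristic `p` is `F`-finite if its Frobenius is a finite map. -/
def IsFFinite (p : ℕ) [Fact p.Prime] (R : Type*) [CommRing R] [CharP R p] : Prop :=
  (frobenius R p).Finite

/-- The set of points of `Spec A` whose local ring is regular. -/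
def regularLocus (A : Type*) [CommRing A] : Set (PrimeSpectrum A) :=
  {x | IsRegularLocalRing (Localization.AtPrime x.asIdeal)}

/-- All irreducible components of `Spec S` have the same dimension. -/
def IsEquidimensional (S : Type*) [CommRing S] : Prop :=
  ∀ P ∈ minimalPrimes S, ∀ Q ∈ minimalPrimes S, ringKrullDim (S ⧸ P) = ringKrullDim (S ⧸ Q)

/-- The reduction `S_red` of a ring `S`. -/
abbrev Reduction (S : Type*) [CommRing S] : Type _ := S ⧸ nilradical S

/-- For `A`-algebras `B` and `R`, the ring `(R ⊗_A F^e_* B)_red`, as an algebra over `F^e_* B`. -/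
abbrev ReducedTwist (p e : ℕ) [Fact p.Prime] (A B R : Type*) [CommRing A] [CommRing B]
    [CommRing R] [CharP B p] [Algebra A B] [Algebra A R] : Type _ :=
  Reduction (FrobeniusPushforward p e B ⊗[A] R)

-- Choose a minimal prime `I` at which `A` is regular and the fiber is non-zero. The local ring at
-- `I` is regular of dimension zero, hence a field, so one element outside `I` kills `I`. Whenever
-- `f ∉ I` is a multiple of that element, `A_f` is a localization of the domain `D = A / I`, and
-- everything left to arrange holds after inverting one more element of `D`.
--
-- The exponent comes from the perfect closure `P` of `κ(I)`. The ring `P ⊗ R` is Noetherian, so its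
-- nilradical is nilpotent and has finitely many generators. The generators involve finitely many
-- elements of `P`, which are `p^e`-power roots of fractions of `A`. For `e` large they are
-- therefore defined over any field `L` over `κ(I)` containing the `p^e`-th roots of the image of
-- `A`. Over a perfect field, field extension creates no new nilpotents: independent vectors stay
-- independent after raising to the power `p^n`. So the nilradical of `AlgebraicClosure L ⊗ R` is
-- generated by nilpotents of `L ⊗ R`, and the reduction of `L ⊗ R` is geometrically reduced
-- (`exists_forall_nilradical_le`). As `A` has finitely many minimal primes, one exponent serves all
-- generic fibers. Reduction commutes with passage to these fibers although `A` may be non-reduced;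
-- `IsFractionsModNil` records what is needed.
--
-- Faithful flatness is generic freeness of the reduced twist over `F^e_* D`, proved with leading
-- monomials, together with non-vanishing. Regularity is generic freeness of the finite Frobenius of
-- `D` followed by the converse of Kunz's theorem, which is deduced from Lech's length estimates.
--
-- For the relative Frobenius, generic freeness of `D ⊗ R` embeds `A_f ⊗ R` into `P ⊗ R`. There the
-- relative Frobenius is the `p^e`-th power of an element obtained by extracting roots in `P`, so it
-- kills nilpotents once `p^e` bounds the nilpotency order in `P ⊗ R`.

universe u v

/-! ### Generic freeness by leading monomials. -/

/-- Dickson's lemma, in the form used to extract finitely many leading monomials. -/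
theorem exists_finset_forall_exists_le {α : Type*} [PartialOrder α] [WellQuasiOrderedLE α]
    (S : Set α) : ∃ t : Finset α, (∀ a ∈ t, a ∈ S) ∧ ∀ s ∈ S, ∃ a ∈ t, a ≤ s := by
  have hfin : {a | Minimal (· ∈ S) a}.Finite :=
    WellQuasiOrderedLE.finite_of_isAntichain (setOfPred_minimal_antichain _)
  refine ⟨hfin.toFinset, fun a ha => ?_, fun s hs => ?_⟩
  · exact ((Set.Finite.mem_toFinset hfin).1 ha).prop
  · obtain ⟨a, ha, hmin⟩ := exists_minimal_le_of_wellFoundedLT (· ∈ S) s hs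
    exact ⟨a, (Set.Finite.mem_toFinset hfin).2 hmin, ha⟩

/-- Generic freeness: an algebra of finite type over a domain contains a free submodule with
cokernel killed by powers of a single nonzero element. -/
theorem Algebra.FiniteType.exists_free_injective (B T : Type*) [CommRing B] [IsDomain B]
    [CommRing T] [Algebra B T] [Algebra.FiniteType B T] :
    ∃ h : B, h ≠ 0 ∧ ∃ (κ : Type) (Φ : (κ →₀ B) →ₗ[B] T), Function.Injective Φ ∧
      ∀ t : T, ∃ n : ℕ, h ^ n • t ∈ LinearMap.range Φ := by
  classical
  obtain ⟨n, π, hπ⟩ := Algebra.FiniteType.iff_quotient_mvPolynomial''.1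
    (inferInstance : Algebra.FiniteType B T)
  let m : MonomialOrder (Fin n) := MonomialOrder.lex
  obtain ⟨t, htS, ht⟩ := exists_finset_forall_exists_le
    {s : Fin n →₀ ℕ | ∃ g, π g = 0 ∧ g ≠ 0 ∧ m.degree g = s}
  have hex : ∀ s : Fin n →₀ ℕ, ∃ g : MvPolynomial (Fin n) B,
      s ∈ t → π g = 0 ∧ g ≠ 0 ∧ m.degree g = s := fun s => by
    by_cases hs : s ∈ t
    · obtain ⟨g, hg⟩ := htS s hs
      exact ⟨g, fun _ => hg⟩
    · exact ⟨0, fun h => absurd h hs⟩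
  choose g hg using hex
  let f : B := ∏ s ∈ t, m.leadingCoeff (g s)
  have hf : f ≠ 0 := Finset.prod_ne_zero_iff.2 fun s hs =>
    m.leadingCoeff_ne_zero_iff.2 (hg s hs).2.1
  -- The standard monomials: those divisible by no leading monomial of the kernel of `π`.
  let κ : Type := {c : Fin n →₀ ℕ // ∀ s ∈ t, ¬ s ≤ c}
  let Φ : (κ →₀ B) →ₗ[B] T :=
    Finsupp.linearCombination B fun c : κ => π (MvPolynomial.monomial c.1 1)
  refine ⟨f, hf, κ, Φ, ?_, ?_⟩
  -- A relation among standard monomials is a kernel element whose leading monomial is itself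
  -- standard, so it vanishes; no inversion of `f` is needed here.
  · rw [← LinearMap.ker_eq_bot, LinearMap.ker_eq_bot']
    intro a ha
    by_contra hne
    let r : MvPolynomial (Fin n) B := Finsupp.linearCombination B
      (fun c : κ => (MvPolynomial.monomial c.1 1 : MvPolynomial (Fin n) B)) a
    have hr : ∀ d, r.coeff d = a.sum fun c x => if c.1 = d then x else 0 := fun d => by
      simp only [r, Finsupp.linearCombination_apply, Finsupp.sum, MvPolynomial.coeff_sum,
        MvPolynomial.smul_monomial, MvPolynomial.coeff_monomial, smul_eq_mul, mul_one]
    have hπr : π r = 0 := by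
      rw [← ha]
      simp only [r, Φ, Finsupp.linearCombination_apply, Finsupp.sum, map_sum, map_smul]
    have hr0 : r ≠ 0 := by
      obtain ⟨c, hc⟩ := Finsupp.ne_iff.1 hne
      refine MvPolynomial.ne_zero_iff.2 ⟨c.1, ?_⟩
      rw [hr, Finsupp.sum, Finset.sum_eq_single c]
      · simpa using hc
      · exact fun c' _ hc' => if_neg fun h => hc' (Subtype.ext h)
      · exact fun h => by simpa using h
    obtain ⟨s, hs, hle⟩ := ht (m.degree r) ⟨r, hπr, hr0, rfl⟩
    have hmem : m.degree r ∈ r.support := m.degree_mem_support hr0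
    rw [MvPolynomial.mem_support_iff, hr] at hmem
    obtain ⟨c, -, hc⟩ := Finset.exists_ne_zero_of_sum_ne_zero hmem
    have hc : c.1 = m.degree r := by
      by_contra h
      exact hc (if_neg h)
    exact c.2 s hs (hc ▸ hle)
  -- Division with remainder, by well-founded induction along the monomial order; each division by a
  -- leading coefficient is replaced by a factor `f`.
  · have hmono : ∀ (d : m.syn) (c : Fin n →₀ ℕ), m.toSyn c = d → ∃ k : ℕ,
        f ^ k • π (MvPolynomial.monomial c 1) ∈ LinearMap.range Φ := by
      intro d
      induction d using WellFoundedLT.induction with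
      | ind d ih =>
      rintro c rfl
      by_cases hc : ∀ s ∈ t, ¬ s ≤ c
      · refine ⟨0, Finsupp.single ⟨c, hc⟩ 1, ?_⟩
        simp [Φ]
      · push Not at hc
        obtain ⟨s, hs, hle⟩ := hc
        obtain ⟨hg0, hgne, hgdeg⟩ := hg s hs
        have hsum : ∀ A : Finset (Fin n →₀ ℕ), (∀ e ∈ A, m.toSyn e < m.toSyn c) →
            ∀ w : (Fin n →₀ ℕ) → B, ∃ k : ℕ,
              f ^ k • ∑ e ∈ A, w e • π (MvPolynomial.monomial e 1) ∈ LinearMap.range Φ := by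
          intro A
          induction A using Finset.induction_on with
          | empty => exact fun _ _ => ⟨0, by simp⟩
          | insert e A he ihA =>
            intro hA w
            obtain ⟨k₁, h₁⟩ := ih _ (hA e (Finset.mem_insert_self e A)) e rfl
            obtain ⟨k₂, h₂⟩ := ihA (fun e' he' => hA e' (Finset.mem_insert_of_mem he')) w
            refine ⟨k₁ + k₂, ?_⟩
            rw [Finset.sum_insert he, smul_add]
            refine add_mem ?_ ?_
            · have := Submodule.smul_mem _ (f ^ k₂ * w e) h₁
              rwa [smul_smul, show f ^ k₂ * w e * f ^ k₁ = f ^ (k₁ + k₂) * w e by ring,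
                ← smul_smul] at this
            · rw [pow_add, ← smul_smul]
              exact Submodule.smul_mem _ _ h₂
        -- subtract the multiple of `g s` with leading monomial `c`
        let v : MvPolynomial (Fin n) B := MvPolynomial.monomial (c - s) 1 * g s
        have hv0 : π v = 0 := by simp [v, hg0]
        have hvdeg : m.degree v = c := by
          rw [m.degree_mul ((MvPolynomial.monomial_eq_zero).not.2 one_ne_zero) hgne, hgdeg,
            m.degree_monomial, if_neg one_ne_zero, tsub_add_cancel_of_le hle]
        have hvlc : v.coeff c = m.leadingCoeff (g s) := by
          have : c = (c - s) + s := (tsub_add_cancel_of_le hle).symm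
          conv_lhs => rw [this]
          rw [MvPolynomial.coeff_monomial_mul, one_mul, MonomialOrder.leadingCoeff, hgdeg]
        have hvne : v ≠ 0 := mul_ne_zero ((MvPolynomial.monomial_eq_zero).not.2 one_ne_zero) hgne
        have hcs : c ∈ v.support := hvdeg ▸ m.degree_mem_support hvne
        have key : m.leadingCoeff (g s) • π (MvPolynomial.monomial c 1) =
            ∑ e ∈ v.support.erase c, (-(v.coeff e)) • π (MvPolynomial.monomial e 1) := by
          have h1 : ∑ e ∈ v.support, v.coeff e • π (MvPolynomial.monomial e 1) = 0 := by
            rw [← hv0]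
            conv_rhs => rw [v.as_sum]
            rw [map_sum]
            refine Finset.sum_congr rfl fun e _ => ?_
            rw [← map_smul, MvPolynomial.smul_monomial, smul_eq_mul, mul_one]
          rw [← Finset.add_sum_erase _ _ hcs, hvlc] at h1
          rw [eq_neg_of_add_eq_zero_left h1, ← Finset.sum_neg_distrib]
          simp only [neg_smul]
        obtain ⟨k, hk⟩ := hsum (v.support.erase c) (fun e he => by
          refine lt_of_le_of_ne (hvdeg ▸ m.le_degree (Finset.mem_of_mem_erase he)) ?_
          exact fun h => Finset.ne_of_mem_erase he (m.toSyn.injective h)) fun e => -(v.coeff e)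
        -- The extra factor `f` supplies the leading coefficient of `g s` that `key` requires.
        refine ⟨k + 1, ?_⟩
        obtain ⟨u, hu⟩ : m.leadingCoeff (g s) ∣ f := Finset.dvd_prod_of_mem _ hs
        have := Submodule.smul_mem _ u hk
        rw [← key, smul_smul, smul_smul] at this
        convert this using 2
        linear_combination f ^ k * hu
    intro x
    obtain ⟨y, rfl⟩ := hπ x
    induction y using MvPolynomial.induction_on' with
    | monomial c a =>
      obtain ⟨k, hk⟩ := hmono _ c rfl
      refine ⟨k, ?_⟩
      have := Submodule.smul_mem _ a hk
      rwa [smul_comm, ← map_smul, MvPolynomial.smul_monomial, smul_eq_mul, mul_one] at this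
    | add y z hy hz =>
      obtain ⟨k₁, h₁⟩ := hy
      obtain ⟨k₂, h₂⟩ := hz
      refine ⟨k₁ + k₂, ?_⟩
      rw [map_add, smul_add]
      refine add_mem ?_ ?_
      · rw [pow_add, mul_comm, ← smul_smul]
        exact Submodule.smul_mem _ _ h₁
      · rw [pow_add, ← smul_smul]
        exact Submodule.smul_mem _ _ h₂

/-- Generic freeness, after any flat base change inverting the given element. -/
theorem Algebra.FiniteType.exists_forall_free_tensorProduct (B T : Type*) [CommRing B] [IsDomain B]
    [CommRing T] [Algebra B T] [Algebra.FiniteType B T] :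
    ∃ h : B, h ≠ 0 ∧ ∀ (B' : Type*) [CommRing B'] [Algebra B B'] [Module.Flat B B'],
      IsUnit (algebraMap B B' h) → Module.Free B' (B' ⊗[B] T) := by
  obtain ⟨h, hh, κ, Φ, hinj, hsurj⟩ := Algebra.FiniteType.exists_free_injective B T
  refine ⟨h, hh, fun B' _ _ _ hu => ?_⟩
  let Ψ : B' ⊗[B] (κ →₀ B) →ₗ[B'] B' ⊗[B] T := Φ.baseChange B'
  have hΨi : Function.Injective Ψ := Module.Flat.lTensor_preserves_injective_linearMap Φ hinj
  have hΨs : Function.Surjective Ψ := by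
    intro z
    change z ∈ LinearMap.range Ψ
    induction z with
    | zero => exact zero_mem _
    | add x y hx hy => exact add_mem hx hy
    | tmul b t =>
      obtain ⟨n, a, ha⟩ := hsurj t
      obtain ⟨u, hu'⟩ := (hu.pow n).exists_left_inv
      refine ⟨(u * b) ⊗ₜ a, ?_⟩
      rw [LinearMap.baseChange_tmul, ha, TensorProduct.tmul_smul, TensorProduct.smul_tmul',
        Algebra.smul_def, map_pow]
      congr 1
      linear_combination b * hu'
  exact Module.Free.of_equiv (LinearEquiv.ofBijective Ψ ⟨hΨi, hΨs⟩)

/-! ### Lech's lemma: lengths of quotients by powers of generators. -/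

section Lech

variable {C : Type*} [CommRing C]

/-- Multiplication by `g` makes `C/(J,h) → C/(J,gh) → C/(J,g) → 0` exact. It need not be injective
on the left, so only its image enters the length formula. -/
theorem Ideal.length_quotient_sup_span_mul_aux (J : Ideal C) (g h : C) :
    ∃ f : (C ⧸ (J ⊔ Ideal.span {h})) →ₗ[C] (C ⧸ (J ⊔ Ideal.span {g * h})),
      (∀ a : C, f (Submodule.Quotient.mk a) = Submodule.Quotient.mk (g * a)) ∧
      Module.length C (C ⧸ (J ⊔ Ideal.span {g * h})) =
        Module.length C (LinearMap.range f) + Module.length C (C ⧸ (J ⊔ Ideal.span {g})) := by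
  have hle : J ⊔ Ideal.span {h} ≤ Submodule.comap (LinearMap.mulLeft C g) (J ⊔ Ideal.span {g * h}) := by
    refine sup_le (fun x hx => ?_) ((Ideal.span_singleton_le_iff_mem _).2 ?_)
    · exact Ideal.mul_mem_left _ _ (Ideal.mem_sup_left hx)
    · exact Ideal.mem_sup_right (Ideal.mem_span_singleton_self _)
  have hle' : J ⊔ Ideal.span {g * h} ≤ J ⊔ Ideal.span {g} :=
    sup_le_sup_left ((Ideal.span_singleton_le_iff_mem _).2
      (Ideal.mul_mem_right _ _ (Ideal.mem_span_singleton_self _))) _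
  let f := Submodule.mapQ _ _ (LinearMap.mulLeft C g) hle
  refine ⟨f, fun a => rfl, ?_⟩
  refine Module.length_eq_add_of_exact (LinearMap.range f).subtype (Submodule.factor hle')
    (Submodule.subtype_injective _) (Submodule.factor_surjective hle') ?_
  rw [LinearMap.exact_iff, Submodule.range_subtype]
  ext z
  obtain ⟨a, rfl⟩ := Submodule.Quotient.mk_surjective _ z
  rw [LinearMap.mem_ker]
  change Submodule.Quotient.mk a = _ ↔ _
  rw [Submodule.Quotient.mk_eq_zero]
  constructor
  · intro ha
    obtain ⟨j, hj, y, hy, rfl⟩ := Submodule.mem_sup.1 ha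
    obtain ⟨b, rfl⟩ := Ideal.mem_span_singleton'.1 hy
    refine ⟨Submodule.Quotient.mk b, (Submodule.Quotient.eq _).2 ?_⟩
    change g * b - (j + b * g) ∈ _
    rw [show g * b - (j + b * g) = -j by ring]
    exact neg_mem (Ideal.mem_sup_left hj)
  · rintro ⟨y, hy⟩
    obtain ⟨b, rfl⟩ := Submodule.Quotient.mk_surjective _ y
    have h1 := hle' ((Submodule.Quotient.eq _).1 hy)
    have h2 : g * b ∈ J ⊔ Ideal.span {g} :=
      Ideal.mem_sup_right (Ideal.mul_mem_right _ _ (Ideal.mem_span_singleton_self _))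
    have := sub_mem h2 h1
    rwa [show g * b - (LinearMap.mulLeft C g b - a) = a by
      rw [LinearMap.mulLeft_apply]; ring] at this

theorem Ideal.length_quotient_sup_span_mul_le (J : Ideal C) (g h : C) :
    Module.length C (C ⧸ (J ⊔ Ideal.span {g * h})) ≤
      Module.length C (C ⧸ (J ⊔ Ideal.span {h})) + Module.length C (C ⧸ (J ⊔ Ideal.span {g})) := by
  obtain ⟨f, -, hf⟩ := Ideal.length_quotient_sup_span_mul_aux J g h
  rw [hf]
  exact add_le_add_left (Module.length_le_of_surjective _ f.surjective_rangeRestrict) _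

theorem Ideal.le_length_quotient_sup_span_mul (J : Ideal C) (g h : C)
    (hgh : ∀ a, g * a ∈ J ⊔ Ideal.span {g * h} → a ∈ J ⊔ Ideal.span {h}) :
    Module.length C (C ⧸ (J ⊔ Ideal.span {h})) + Module.length C (C ⧸ (J ⊔ Ideal.span {g})) ≤
      Module.length C (C ⧸ (J ⊔ Ideal.span {g * h})) := by
  obtain ⟨f, hf', hf⟩ := Ideal.length_quotient_sup_span_mul_aux J g h
  rw [hf]
  refine add_le_add_left (Module.length_le_of_injective f.rangeRestrict ?_) _
  rw [← LinearMap.ker_eq_bot, LinearMap.ker_rangeRestrict, LinearMap.ker_eq_bot']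
  intro y hy
  obtain ⟨a, rfl⟩ := Submodule.Quotient.mk_surjective _ y
  rw [hf', Submodule.Quotient.mk_eq_zero] at hy
  exact (Submodule.Quotient.mk_eq_zero _).2 (hgh a hy)

variable {ι : Type*} [DecidableEq ι]

theorem Ideal.span_range_update (f : ι → C) (i : ι) (y : C) :
    Ideal.span (Set.range (Function.update f i y)) =
      Ideal.span (f '' {i}ᶜ) ⊔ Ideal.span {y} := by
  rw [← Ideal.span_union]
  congr 1
  ext z
  simp only [Set.mem_range, Set.mem_union, Set.mem_image, Set.mem_compl_iff,
    Set.mem_singleton_iff]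
  constructor
  · rintro ⟨j, rfl⟩
    by_cases hj : j = i
    · subst hj; simp
    · exact Or.inl ⟨j, hj, by simp [hj]⟩
  · rintro (⟨j, hj, rfl⟩ | rfl)
    · exact ⟨j, by simp [hj]⟩
    · exact ⟨i, by simp⟩


theorem Ideal.mem_span_range_update_of_mem {f : ι → C} {i : ι} {g h : C} (hi : f i = g * h)
    {x : C} (hx : x ∈ Ideal.span (Set.range f)) :
    x ∈ Ideal.span (Set.range (Function.update f i g)) := by
  refine Ideal.span_le.2 ?_ hx
  rintro _ ⟨j, rfl⟩
  by_cases hj : j = i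
  · subst hj
    rw [hi]
    exact Ideal.mul_mem_right _ _ (Ideal.subset_span ⟨j, by simp⟩)
  · exact Ideal.subset_span ⟨j, by simp [hj]⟩

theorem pow_update_eq (x : ι → C) (n : ι → ℕ) (i : ι) (k : ℕ) :
    (fun j => x j ^ Function.update n i k j) = Function.update (fun j => x j ^ n j) i (x i ^ k) := by
  ext j
  by_cases hj : j = i
  · subst hj; simp
  · simp [hj]


theorem span_range_pow_split (x : ι → C) (n : ι → ℕ) (i : ι) (k : ℕ) (hk : n i = k + 1) :
    Ideal.span (Set.range fun j => x j ^ n j) =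
      Ideal.span ((fun j => x j ^ n j) '' {i}ᶜ) ⊔ Ideal.span {x i ^ k * x i} := by
  rw [← Ideal.span_range_update, ← pow_succ, ← hk, Function.update_eq_self_iff.2 rfl]

variable [Fintype ι]

/-- A family is Lech independent if the coefficients of each of its linear relations lie in the
ideal it generates. -/
def LechIndependent (f : ι → C) : Prop :=
  ∀ a : ι → C, ∑ j, a j * f j = 0 → ∀ j, a j ∈ Ideal.span (Set.range f)

/-- Multiplying the relation by `h` turns it into a relation of `f` whose coefficient at `i` is
still `a i`. -/
theorem LechIndependent.mem_of_sum {f : ι → C} (hf : LechIndependent f) {i : ι} {g h : C}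
    (hi : f i = g * h) {a : ι → C} (ha : ∑ j, a j * Function.update f i g j = 0) :
    a i ∈ Ideal.span (Set.range f) := by
  have := hf (Function.update (fun j => h * a j) i (a i)) (by
    rw [← mul_zero h, ← ha, Finset.mul_sum]
    refine Finset.sum_congr rfl fun j _ => ?_
    by_cases hj : j = i
    · subst hj; simp [hi]; ring
    · simp [hj]; ring) i
  simpa using this

/-- By `mem_of_sum`, `a i = ∑ b j * f j`. Substituting this into the relation gives a relation of
`f` with coefficients `a j + b j * g` for `j ≠ i`, and `g` belongs to the new ideal. -/
theorem LechIndependent.update {f : ι → C} (hf : LechIndependent f) {i : ι} {g h : C}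
    (hi : f i = g * h) : LechIndependent (Function.update f i g) := by
  intro a ha j
  have hai := hf.mem_of_sum hi ha
  obtain ⟨b, hb⟩ := Ideal.mem_span_range_iff_exists_fun.1 hai
  by_cases hj : j = i
  · subst hj; exact Ideal.mem_span_range_update_of_mem hi hai
  have key := hf (fun j => (if j = i then 0 else a j) + b j * g) (by
    refine Eq.trans ?_ ha
    have : ∑ j, a j * Function.update f i g j =
        ∑ j, ((if j = i then 0 else a j) * f j + if j = i then a i * g else 0) := by
      refine Finset.sum_congr rfl fun j _ => ?_
      by_cases hj : j = i
      · subst hj; simp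
      · simp [hj]
    rw [this, Finset.sum_add_distrib, Finset.sum_ite_eq' Finset.univ i,
      if_pos (Finset.mem_univ i)]
    rw [← hb, Finset.sum_mul, ← Finset.sum_add_distrib]
    refine Finset.sum_congr rfl fun j _ => ?_
    split_ifs <;> ring) j
  rw [if_neg hj] at key
  have hg : g ∈ Ideal.span (Set.range (Function.update f i g)) :=
    Ideal.subset_span ⟨i, by simp⟩
  have := sub_mem (Ideal.mem_span_range_update_of_mem hi key) (Ideal.mul_mem_left _ (b j) hg)
  rwa [add_sub_cancel_right] at this

/-- This is the injectivity of multiplication by `g` in the exact sequence. If `g * a = ∑ b j * f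
j`, then `b i * h - a` is the coefficient of `g` in a relation of the updated family. -/
theorem LechIndependent.mem_of_mul_mem {f : ι → C} (hf : LechIndependent f) {i : ι} {g h : C}
    (hi : f i = g * h) {a : C} (ha : g * a ∈ Ideal.span (Set.range f)) :
    a ∈ Ideal.span (Set.range (Function.update f i h)) := by
  obtain ⟨b, hb⟩ := Ideal.mem_span_range_iff_exists_fun.1 ha
  have hi' : f i = h * g := by rw [hi, mul_comm]
  have key := hf.mem_of_sum (i := i) hi (a := fun j => if j = i then b i * h - a else b j) (by
    have : ∀ j, (if j = i then b i * h - a else b j) * Function.update f i g j =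
        b j * f j - if j = i then g * a else 0 := by
      intro j
      by_cases hj : j = i
      · subst hj; simp [hi]; ring
      · simp [hj]
    simp only [this, Finset.sum_sub_distrib, hb, Finset.sum_ite_eq', Finset.mem_univ, if_true,
      sub_self])
  simp only [if_true] at key
  have hh : h ∈ Ideal.span (Set.range (Function.update f i h)) :=
    Ideal.subset_span ⟨i, by simp⟩
  have := sub_mem (Ideal.mul_mem_left _ (b i) hh) (Ideal.mem_span_range_update_of_mem hi' key)
  rwa [sub_sub_cancel] at this

/-- Induction on exponent vectors with positive entries, splitting off one factor at a time. -/
theorem exponent_induction {motive : (ι → ℕ) → Prop} (one : motive fun _ => 1)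
    (step : ∀ (n : ι → ℕ) (i : ι) (k : ℕ), (∀ j, 1 ≤ n j) → 1 ≤ k → n i = k + 1 →
      motive (Function.update n i k) → motive (Function.update n i 1) → motive n)
    (n : ι → ℕ) (hn : ∀ j, 1 ≤ n j) : motive n := by
  induction hs : ∑ j, n j using Nat.strong_induction_on generalizing n with
  | _ s ih =>
  by_cases h1 : ∀ j, n j = 1
  · rwa [show n = fun _ => 1 from funext h1]
  · push Not at h1
    obtain ⟨i, hi⟩ := h1
    obtain ⟨k, hk⟩ : ∃ k, n i = k + 1 := ⟨n i - 1, by have := hn i; omega⟩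
    have hk1 : 1 ≤ k := by omega
    have hlt : ∀ l, 1 ≤ l → l < n i → motive (Function.update n i l) := fun l hl hlt => by
      refine ih _ ?_ _ (fun j => ?_) rfl
      · rw [← hs]
        refine Finset.sum_lt_sum (fun j _ => ?_) ⟨i, Finset.mem_univ i, by simpa using hlt⟩
        by_cases hj : j = i
        · subst hj; simpa using hlt.le
        · simp [hj]
      · by_cases hj : j = i
        · subst hj; simpa using hl
        · simpa [hj] using hn j
    exact step n i k hn hk1 hk (hlt k hk1 (by omega)) (hlt 1 le_rfl (by omega))

theorem prod_update_split (n : ι → ℕ) (i : ι) (k : ℕ) (hk : n i = k + 1) :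
    ∏ j, n j = ∏ j, Function.update n i 1 j + ∏ j, Function.update n i k j := by
  rw [Finset.prod_update_of_mem (Finset.mem_univ i), Finset.prod_update_of_mem (Finset.mem_univ i),
    Fintype.prod_eq_mul_prod_compl i, hk, Finset.compl_eq_univ_sdiff]
  ring

/-- Right exactness alone gives the upper bound, for arbitrary elements. -/
theorem Ideal.length_quotient_span_pow_le (x : ι → C) (n : ι → ℕ) (hn : ∀ j, 1 ≤ n j) :
    Module.length C (C ⧸ Ideal.span (Set.range fun j => x j ^ n j)) ≤
      (∏ j, n j : ℕ) * Module.length C (C ⧸ Ideal.span (Set.range x)) := by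
  refine exponent_induction (motive := fun n => Module.length C
    (C ⧸ Ideal.span (Set.range fun j => x j ^ n j)) ≤
      (∏ j, n j : ℕ) * Module.length C (C ⧸ Ideal.span (Set.range x))) ?_ ?_ n hn
  · have h1 : (fun j => x j ^ 1) = x := funext fun j => pow_one _
    rw [h1, Finset.prod_const_one, Nat.cast_one, one_mul]
  · intro n i k hn hk1 hk h₁ h₂
    rw [pow_update_eq, Ideal.span_range_update] at h₁ h₂
    rw [pow_one] at h₂
    rw [span_range_pow_split x n i k hk, prod_update_split n i k hk, Nat.cast_add, add_mul]
    exact (Ideal.length_quotient_sup_span_mul_le _ _ _).trans (add_le_add h₂ h₁)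

/-- Lech's lemma, as a lower bound for the length. -/
theorem LechIndependent.prod_le_length [Nontrivial C] (x : ι → C) (n : ι → ℕ)
    (hn : ∀ j, 1 ≤ n j) (hx : Ideal.span (Set.range x) ≠ ⊤)
    (hli : LechIndependent fun j => x j ^ n j) :
    ((∏ j, n j : ℕ) : ℕ∞) ≤ Module.length C (C ⧸ Ideal.span (Set.range fun j => x j ^ n j)) := by
  refine exponent_induction (motive := fun n => LechIndependent (fun j => x j ^ n j) →
    ((∏ j, n j : ℕ) : ℕ∞) ≤ Module.length C (C ⧸ Ideal.span (Set.range fun j => x j ^ n j)))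
    ?_ ?_ n hn hli
  · intro _
    have : Nontrivial (C ⧸ Ideal.span (Set.range x)) := Ideal.Quotient.nontrivial_iff.2 hx
    simpa [Order.one_le_iff_ne_zero, Module.length_eq_zero_iff, not_subsingleton_iff_nontrivial]
      using this
  · intro n i k hn hk1 hk h₁ h₂ hli
    have hi : (fun j => x j ^ n j) i = x i ^ k * x i := by
      change x i ^ n i = _
      rw [hk, pow_succ]
    rw [pow_update_eq, Ideal.span_range_update] at h₁ h₂
    rw [pow_one] at h₂
    rw [span_range_pow_split x n i k hk, prod_update_split n i k hk, Nat.cast_add]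
    refine le_trans (add_le_add (h₂ (hli.update (hi.trans (mul_comm _ _)))) (h₁ (hli.update hi)))
      (Ideal.le_length_quotient_sup_span_mul _ _ _ fun a ha => ?_)
    rw [← span_range_pow_split x n i k hk] at ha
    rw [← Ideal.span_range_update]
    exact hli.mem_of_mul_mem hi ha

end Lech

/-! ### Flat Frobenius implies regularity for local rings. -/

theorem FrobeniusPushforward.smul_of (p e : ℕ) [Fact p.Prime] {A B : Type*} [CommRing A]
    [CommRing B] [CharP B p] [Algebra A B] (a : A) (b : B) :
    a • FrobeniusPushforward.of p e B b =
      FrobeniusPushforward.of p e B (algebraMap A B a ^ p ^ e * b) := by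
  rw [Algebra.smul_def, FrobeniusPushforward.algebraMap_apply, ← map_mul]

section Kunz

variable {C : Type*} [CommRing C]

/-- A unit coefficient in a relation would make one generator redundant, contradicting the minimal
cardinality. -/
theorem IsLocalRing.exists_minimal_generators [IsLocalRing C] [IsNoetherianRing C] :
    ∃ s : Finset C, s.card = (IsLocalRing.maximalIdeal C).spanFinrank ∧
      Ideal.span (s : Set C) = IsLocalRing.maximalIdeal C ∧
      ∀ c : s → C, ∑ i : s, (i : C) * c i = 0 → ∀ i, c i ∈ IsLocalRing.maximalIdeal C := by
  classical
  obtain ⟨s, hcard, hs⟩ := Submodule.FG.exists_span_finset_card_eq_spanFinrank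
    (IsNoetherian.noetherian (IsLocalRing.maximalIdeal C))
  refine ⟨s, hcard, hs, fun c hc i => ?_⟩
  by_contra hi
  have hu : IsUnit (c i) := by simpa using hi
  have hmem : (i : C) ∈ Ideal.span ((s.erase i : Finset C) : Set C) := by
    rw [← Ideal.mul_unit_mem_iff_mem _ hu]
    rw [← Finset.add_sum_erase _ _ (Finset.mem_univ i)] at hc
    rw [eq_neg_of_add_eq_zero_left hc]
    refine neg_mem (sum_mem fun j hj => Ideal.mul_mem_right _ _ (Ideal.subset_span ?_))
    have : (j : C) ≠ i := fun h => Finset.ne_of_mem_erase hj (Subtype.ext h)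
    simp [this]
  have hspan : Ideal.span ((s.erase i : Finset C) : Set C) = IsLocalRing.maximalIdeal C := by
    rw [← hs]
    refine le_antisymm (Ideal.span_mono (by simp)) (Ideal.span_le.2 fun y hy => ?_)
    by_cases hyi : y = i
    · rw [hyi]; exact hmem
    · exact Ideal.subset_span (by simpa [hyi] using hy)
  have h1 := Submodule.spanFinrank_span_le_ncard_of_finite (R := C)
    (s := ((s.erase i : Finset C) : Set C)) (Finset.finite_toSet _)
  rw [← Ideal.span] at h1
  rw [hspan, ← hcard, Set.ncard_coe_finset, Finset.card_erase_of_mem i.2] at h1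
  have := Finset.card_pos.2 ⟨_, i.2⟩
  omega

theorem Ideal.pow_mem_span_range_pow (p e : ℕ) [Fact p.Prime] [CharP C p] {s : Finset C} {z : C}
    (hz : z ∈ Ideal.span (s : Set C)) :
    z ^ p ^ e ∈ Ideal.span (Set.range fun i : s => (i : C) ^ p ^ e) := by
  have := Ideal.mem_map_of_mem (iterateFrobenius C p e) hz
  rw [Ideal.map_span, iterateFrobenius_def] at this
  refine Ideal.span_mono ?_ this
  rintro _ ⟨w, hw, rfl⟩
  exact ⟨⟨w, hw⟩, rfl⟩

/-- A relation among the powers `x_i ^ q` is a relation among the `x_i` in `F^e_* C`. By the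
equational criterion of flatness, its coefficients are combinations of `c ^ q`, where the `c` are
coefficients of relations in `C`. Minimality puts these `c` in the maximal ideal, so each `c ^ q`
lies in the ideal of the `x_i ^ q`. -/
theorem LechIndependent.of_flat_frobenius (p e : ℕ) [Fact p.Prime] [CharP C p] [IsLocalRing C]
    [Module.Flat C (FrobeniusPushforward p e C)] (s : Finset C)
    (hs : Ideal.span (s : Set C) = IsLocalRing.maximalIdeal C)
    (hmin : ∀ c : s → C, ∑ i : s, (i : C) * c i = 0 → ∀ i, c i ∈ IsLocalRing.maximalIdeal C) :
    LechIndependent fun i : s => (i : C) ^ p ^ e := by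
  intro a ha i
  have h0 : ∑ i : s, (i : C) • FrobeniusPushforward.of p e C (a i) = 0 := by
    simp only [FrobeniusPushforward.smul_of]
    rw [← map_sum, ← map_zero (FrobeniusPushforward.of p e C), ← ha]
    exact congr_arg _ (Finset.sum_congr rfl fun i _ => mul_comm _ _)
  have htriv := @Module.Flat.isTrivialRelation_of_sum_smul_eq_zero C (FrobeniusPushforward p e C)
    _ _ _ _ s _ (fun i => i) (fun i => FrobeniusPushforward.of p e C (a i))
  obtain ⟨k, c, y, hy, hc⟩ := htriv h0
  obtain ⟨z, rfl⟩ : ∃ z : Fin k → C, y = fun j => FrobeniusPushforward.of p e C (z j) :=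
    ⟨fun j => (FrobeniusPushforward.of p e C).symm (y j), funext fun j =>
      ((FrobeniusPushforward.of p e C).apply_symm_apply (y j)).symm⟩
  have hai : FrobeniusPushforward.of p e C (a i) =
      FrobeniusPushforward.of p e C (∑ j, c i j ^ p ^ e * z j) := by
    refine (hy i).trans ?_
    rw [map_sum]
    exact Finset.sum_congr rfl fun j _ => FrobeniusPushforward.smul_of p e _ _
  rw [(FrobeniusPushforward.of p e C).injective hai]
  exact sum_mem fun j _ => Ideal.mul_mem_right _ _
    (Ideal.pow_mem_span_range_pow p e (hs ▸ hmin _ (hc j) i))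

/-- The converse part of Kunz's theorem. -/
theorem IsRegularLocalRing.of_flat_frobenius (p : ℕ) [Fact p.Prime] [CharP C p] [IsLocalRing C]
    [IsNoetherianRing C] (hflat : ∀ e, Module.Flat C (FrobeniusPushforward p e C)) :
    IsRegularLocalRing C := by
  classical
  have hp : 1 < p := (Fact.out : p.Prime).one_lt
  obtain ⟨s, hcard, hs, hmin⟩ := IsLocalRing.exists_minimal_generators (C := C)
  -- A parameter ideal: `J` has as many generators as the dimension, and finite colength.
  obtain ⟨J, hJ, hJr, hJh⟩ := Ideal.exists_spanRank_eq_and_height_eq (IsLocalRing.maximalIdeal C)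
    Ideal.IsPrime.ne_top'
  obtain ⟨t, htcard, ht⟩ := Submodule.FG.exists_span_finset_card_eq_spanFinrank
    (IsNoetherian.noetherian J)
  have hart : IsArtinianRing (C ⧸ J) :=
    IsLocalRing.quotient_artinian_of_mem_minimalPrimes_of_isLocalRing J
      (Ideal.mem_minimalPrimes_of_height_le hJ hJh.ge)
  have hlen : Module.length C (C ⧸ J) ≠ ⊤ := by
    rw [Module.length_eq_of_surjective (S := C) (R := C ⧸ J) Ideal.Quotient.mk_surjective]
    exact Module.length_ne_top
  have hdim : ringKrullDim C = t.card := by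
    rw [← IsLocalRing.maximalIdeal_height_eq_ringKrullDim]
    rw [(Submodule.fg_iff_spanRank_eq_spanFinrank.2 (IsNoetherian.noetherian J)), ← htcard] at hJr
    have : (IsLocalRing.maximalIdeal C).height = t.card := by
      apply Cardinal.ofENat_injective
      rw [← hJr]; simp
    rw [this]; rfl
  apply IsRegularLocalRing.of_spanFinrank_maximalIdeal_le
  rw [hdim, ← hcard]
  norm_cast
  obtain ⟨l, hl⟩ := ENat.ne_top_iff_exists.1 hlen
  -- With `q = p ^ e`, compare Lech's lower bound for the minimal generators with the upper bound
  -- for the parameters; the `q`-th powers of the latter lie in the ideal of the `q`-th powers of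
  -- the former.
  have key : ∀ e, (p ^ e) ^ s.card ≤ (p ^ e) ^ t.card * l := by
    intro e
    have hq : 1 ≤ p ^ e := Nat.one_le_pow _ _ (by omega)
    have hs' : Ideal.span (Set.range (Subtype.val : s → C)) = IsLocalRing.maximalIdeal C := by
      rw [← hs]; simp
    have ht' : Ideal.span (Set.range (Subtype.val : t → C)) = J := by
      rw [← ht]; simp [Ideal.span]
    have := hflat e
    have h1 := LechIndependent.prod_le_length (Subtype.val : s → C) (fun _ => p ^ e)
      (fun _ => hq) (by rw [hs']; exact Ideal.IsPrime.ne_top')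
      (LechIndependent.of_flat_frobenius p e s hs hmin)
    have h2 := Ideal.length_quotient_span_pow_le (Subtype.val : t → C) (fun _ => p ^ e) fun _ => hq
    have hle : Ideal.span (Set.range fun i : t => (i : C) ^ p ^ e) ≤
        Ideal.span (Set.range fun i : s => (i : C) ^ p ^ e) := by
      rw [Ideal.span_le]
      rintro _ ⟨i, rfl⟩
      have hi : (i : C) ∈ Ideal.span (s : Set C) := by
        rw [hs]; exact hJ (ht ▸ Submodule.subset_span i.2)
      exact Ideal.pow_mem_span_range_pow p e hi
    have h3 := Module.length_le_of_surjective (Submodule.factor hle)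
      (Submodule.factor_surjective hle)
    have h4 := (h1.trans h3).trans h2
    rw [ht', ← hl] at h4
    simpa using (by exact_mod_cast h4 :
      (∏ _j : s, p ^ e) ≤ (∏ _j : t, p ^ e) * l)
  by_contra hlt
  push Not at hlt
  -- The exponent `e = l` suffices: too many generators would force `p ^ l ≤ l`.
  have h1 := key l
  obtain ⟨k, hk⟩ := Nat.exists_eq_add_of_lt hlt
  have hpos : 0 < (p ^ l) ^ t.card := by positivity
  rw [hk, add_assoc, pow_add] at h1
  have h2 := Nat.le_of_mul_le_mul_left h1 hpos
  have h3 : p ^ l ≤ (p ^ l) ^ (k + 1) := Nat.le_self_pow (by omega) _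
  have h4 : l < p ^ l := Nat.lt_pow_self hp
  omega

end Kunz

/-! ### Nilradicals under passage to fractions modulo nilpotents. -/

section Fractions

variable (B L : Type*) [CommRing B] [CommRing L] [Algebra B L]

/-- The elements of `L` are fractions of elements of `B`, and the kernel of `B → L` becomes nil
after inverting the elements of `B` that are invertible in `L`. Both localizations and the residue
fields of minimal primes have this property. -/
structure IsFractionsModNil : Prop where
  surj : ∀ l : L, ∃ b s : B, IsUnit (algebraMap B L s) ∧ algebraMap B L s * l = algebraMap B L b
  nil : ∀ b : B, algebraMap B L b = 0 → ∃ s : B, IsUnit (algebraMap B L s) ∧ IsNilpotent (s * b)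

variable {B L}

theorem IsFractionsModNil.exists_smul_tmul (h : IsFractionsModNil B L) {T : Type*} [CommRing T]
    [Algebra B T] (z : L ⊗[B] T) :
    ∃ (s : B) (t : T), IsUnit (algebraMap B L s) ∧ s • z = 1 ⊗ₜ t := by
  induction z with
  | zero => exact ⟨1, 0, by simp, by simp⟩
  | tmul l t =>
    obtain ⟨b, s, hs, hb⟩ := h.surj l
    refine ⟨s, b • t, hs, ?_⟩
    rw [TensorProduct.tmul_smul, TensorProduct.smul_tmul', TensorProduct.smul_tmul',
      Algebra.smul_def, Algebra.smul_def, hb, mul_one]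
  | add x y hx hy =>
    obtain ⟨s₁, t₁, h₁, e₁⟩ := hx
    obtain ⟨s₂, t₂, h₂, e₂⟩ := hy
    refine ⟨s₁ * s₂, s₂ • t₁ + s₁ • t₂, by rw [map_mul]; exact h₁.mul h₂, ?_⟩
    rw [smul_add, mul_comm, mul_smul, e₁, mul_comm, mul_smul, e₂, TensorProduct.tmul_add,
      TensorProduct.tmul_smul, TensorProduct.tmul_smul]

/-- Here `L` is the localization of `B / I`, with `I` the kernel of `B → L`. So `1 ⊗ t = 0` means
that a multiple of `t` by a denominator lies in `I T`, and elements of `I` become nilpotent after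
multiplication by further denominators. -/
theorem IsFractionsModNil.exists_isNilpotent_smul (h : IsFractionsModNil B L) {T : Type*}
    [CommRing T] [Algebra B T] {t : T} (ht : (1 : L) ⊗ₜ[B] t = 0) :
    ∃ s : B, IsUnit (algebraMap B L s) ∧ IsNilpotent (s • t) := by
  let M : Submonoid B := (IsUnit.submonoid L).comap (algebraMap B L)
  let I : Ideal B := RingHom.ker (algebraMap B L)
  let φ : (B ⧸ I) →ₗ[B] L := Submodule.liftQ I (Algebra.linearMap B L) (fun _ hx => hx)
  have hφ : ∀ b : B, φ (Submodule.Quotient.mk b) = algebraMap B L b := fun _ => rfl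
  have : IsLocalizedModule M φ := by
    refine ⟨fun s => ?_, fun l => ?_, fun {x y} hxy => ⟨1, ?_⟩⟩
    · rw [Module.End.isUnit_iff]
      have hs : IsUnit (algebraMap B L s) := s.2
      have := IsUnit.isUnit_iff_mulLeft_bijective.1 hs
      refine (funext fun l => ?_ : ⇑(algebraMap B (Module.End B L) s) = _) ▸ this
      rw [Module.algebraMap_end_apply, Algebra.smul_def]
    · obtain ⟨b, s, hs, hb⟩ := h.surj l
      exact ⟨⟨Submodule.Quotient.mk b, ⟨s, hs⟩⟩, by
        rw [hφ, ← hb, Submonoid.smul_def, Algebra.smul_def]⟩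
    · obtain ⟨x, rfl⟩ := Submodule.Quotient.mk_surjective _ x
      obtain ⟨y, rfl⟩ := Submodule.Quotient.mk_surjective _ y
      rw [hφ, hφ, ← sub_eq_zero, ← map_sub] at hxy
      rw [(Submodule.Quotient.eq I).2 hxy]
  have h0 : TensorProduct.AlgebraTensorModule.rTensor B T φ
      ((Submodule.Quotient.mk (1 : B) : B ⧸ I) ⊗ₜ t) =
      TensorProduct.AlgebraTensorModule.rTensor B T φ 0 := by
    rw [map_zero, ← ht]
    change φ _ ⊗ₜ t = _
    rw [hφ, map_one]
  obtain ⟨⟨u, hu⟩, huz⟩ := IsLocalizedModule.exists_of_eq (S := M)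
    (f := TensorProduct.AlgebraTensorModule.rTensor B T φ) h0
  rw [smul_zero, Submonoid.smul_def, ← TensorProduct.tmul_smul] at huz
  have hmem : u • t ∈ I • (⊤ : Submodule B T) := by
    have := congr_arg (TensorProduct.quotTensorEquivQuotSMul T I) huz
    rw [map_zero] at this
    rw [← Submodule.Quotient.mk_eq_zero, ← this]
    exact (one_smul B _).symm
  -- Collecting these elements in a submodule reduces the claim for `I T` to products `b • x` with
  -- `b ∈ I`.
  let N : Submodule B T :=
    { carrier := {x | ∃ v ∈ M, IsNilpotent (v • x)}
      zero_mem' := ⟨1, one_mem _, by simp⟩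
      add_mem' := by
        rintro x y ⟨v, hv, hx⟩ ⟨w, hw, hy⟩
        refine ⟨v * w, mul_mem hv hw, ?_⟩
        rw [smul_add]
        refine (Commute.all _ _).isNilpotent_add ?_ ?_
        · rw [mul_comm, mul_smul]
          exact hx.smul w
        · rw [mul_smul]
          exact hy.smul v
      smul_mem' := by
        rintro b x ⟨v, hv, hx⟩
        exact ⟨v, hv, by rw [smul_comm]; exact hx.smul b⟩ }
  have hIN : I • (⊤ : Submodule B T) ≤ N := by
    refine Submodule.smul_le.2 fun b hb x _ => ?_
    obtain ⟨s, hs, hsb⟩ := h.nil b hb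
    refine ⟨s, hs, ?_⟩
    rw [smul_smul, Algebra.smul_def]
    exact (Commute.all _ _).isNilpotent_mul_right (hsb.map (algebraMap B T))
  obtain ⟨v, hv, hn⟩ := hIN hmem
  exact ⟨v * u, M.mul_mem hv hu, by rwa [mul_smul]⟩

/-- Nilpotents of `L ⊗ T` come from nilpotents of `T`. -/
theorem IsFractionsModNil.nilradical_tensorProduct_le (h : IsFractionsModNil B L) (T : Type*)
    [CommRing T] [Algebra B T] :
    nilradical (L ⊗[B] T) ≤
      (nilradical T).map (Algebra.TensorProduct.includeRight : T →ₐ[B] L ⊗[B] T).toRingHom := by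
  intro z hz
  obtain ⟨s, t, hs, hst⟩ := h.exists_smul_tmul z
  have hn : IsNilpotent ((1 : L) ⊗ₜ[B] t) := hst ▸ IsNilpotent.smul hz s
  obtain ⟨n, hn⟩ := hn
  rw [Algebra.TensorProduct.tmul_pow, one_pow] at hn
  obtain ⟨v, hv, hvt⟩ := h.exists_isNilpotent_smul hn
  have hvt' : v • t ∈ nilradical T := by
    have h1 : IsNilpotent ((v • t) ^ (n + 1)) := by
      have : (v • t) ^ (n + 1) = v • t ^ n * v ^ n • t := by
        simp only [Algebra.smul_def, map_pow]; ring
      rw [this]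
      exact (Commute.all _ _).isNilpotent_mul_right hvt
    obtain ⟨k, hk⟩ := h1
    exact mem_nilradical.2 ⟨(n + 1) * k, by rw [pow_mul, hk]⟩
  have hmem := Ideal.mem_map_of_mem
    (Algebra.TensorProduct.includeRight : T →ₐ[B] L ⊗[B] T).toRingHom hvt'
  have hu : IsUnit (algebraMap B (L ⊗[B] T) (v * s)) := by
    rw [IsScalarTower.algebraMap_apply B L (L ⊗[B] T), map_mul]
    exact (hv.mul hs).map _
  rw [← Ideal.unit_mul_mem_iff_mem _ hu, ← Algebra.smul_def, mul_smul, hst]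
  convert hmem using 1
  exact (TensorProduct.tmul_smul v (1 : L) t).symm

end Fractions

/-! ### Nilpotents over perfect fields and their fields of definition. -/

section Perfect

variable (p : ℕ) [Fact p.Prime]

theorem TensorProduct.eq_zero_of_sum_tmul_eq_zero {P M N ι : Type*} [Field P] [AddCommGroup M]
    [Module P M] [AddCommGroup N] [Module P N] {v : ι → M} (hv : LinearIndependent P v)
    (c : ι →₀ N) (hc : (c.sum fun i n => v i ⊗ₜ[P] n) = 0) : c = 0 := by
  have hinj := Module.Flat.rTensor_preserves_injective_linearMap (M := N)
    (Finsupp.linearCombination P v) hv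
  refine TensorProduct.sum_tmul_basis_left_eq_zero (R := P) (Finsupp.basisSingleOne (R := P)) c ?_
  apply hinj
  rw [map_zero, ← hc, Finsupp.sum, map_sum]
  exact Finset.sum_congr rfl fun i _ => by simp

/-- Every coefficient is a `p ^ k`-th power, so a relation among the powers is the Frobenius image
of a relation among the `v i`. -/
theorem LinearIndependent.pow_of_perfectRing {P Λ ι : Type*} [Field P] [Field Λ] [CharP P p]
    [PerfectRing P p] [Algebra P Λ] {v : ι → Λ} (hv : LinearIndependent P v) (k : ℕ) :
    LinearIndependent P fun i => v i ^ p ^ k := by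
  have : CharP Λ p := charP_of_injective_algebraMap (algebraMap P Λ).injective p
  rw [linearIndependent_iff'] at hv ⊢
  intro s g hg i hi
  choose d hd using fun i => (bijective_iterateFrobenius (R := P) p k).2 (g i)
  simp only [iterateFrobenius_def] at hd
  have h0 : iterateFrobenius Λ p k (∑ i ∈ s, d i • v i) = 0 := by
    rw [map_sum, ← hg]
    refine Finset.sum_congr rfl fun j _ => ?_
    rw [← hd j, Algebra.smul_def, Algebra.smul_def, iterateFrobenius_def, mul_pow, map_pow]
  rw [iterateFrobenius_def] at h0
  rw [← hd i, hv s d (eq_zero_of_pow_eq_zero h0) i hi, zero_pow (pow_ne_zero _ (Fact.out : p.Prime).ne_zero)]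

/-- Nilpotents do not appear under extensions of a perfect field. -/
theorem nilradical_tensorProduct_le_of_perfectRing (P Λ S : Type*) [Field P] [Field Λ] [CharP P p]
    [PerfectRing P p] [Algebra P Λ] [CommRing S] [Algebra P S] :
    nilradical (Λ ⊗[P] S) ≤
      (nilradical S).map (Algebra.TensorProduct.includeRight : S →ₐ[P] Λ ⊗[P] S).toRingHom := by
  rcases subsingleton_or_nontrivial (Λ ⊗[P] S) with hss | hnt
  · intro z _
    rw [Subsingleton.elim z 0]
    exact zero_mem _
  have : CharP (Λ ⊗[P] S) p := charP_of_injective_algebraMap (algebraMap P _).injective p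
  intro z hz
  let b := Module.Basis.ofVectorSpace P Λ
  obtain ⟨c, rfl⟩ := TensorProduct.eq_repr_basis_left b z
  obtain ⟨n, hn⟩ := mem_nilradical.1 hz
  have hn' : (c.sum fun i s => b i ⊗ₜ[P] s) ^ p ^ n = 0 :=
    pow_eq_zero_of_le (Nat.lt_pow_self (Fact.out : p.Prime).one_lt).le hn
  -- The `p ^ n`-th power of `∑ b i ⊗ c i` is `∑ b i ^ p ^ n ⊗ c i ^ p ^ n`. As the `b i ^ p ^ n`
  -- remain independent, every `c i` is nilpotent.
  let c' := c.mapRange (fun s => s ^ p ^ n)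
    (zero_pow (pow_ne_zero _ (Fact.out : p.Prime).ne_zero))
  have hc' : c' = 0 := by
    refine TensorProduct.eq_zero_of_sum_tmul_eq_zero
      (b.linearIndependent.pow_of_perfectRing p n) c' ?_
    rw [← hn', ← iterateFrobenius_def, Finsupp.sum_mapRange_index (by simp), Finsupp.sum,
      Finsupp.sum, map_sum]
    exact Finset.sum_congr rfl fun i _ => by
      rw [iterateFrobenius_def, Algebra.TensorProduct.tmul_pow]
  refine sum_mem fun i _ => ?_
  have hi : c i ∈ nilradical S :=
    mem_nilradical.2 ⟨p ^ n, by simpa [c'] using DFunLike.congr_fun hc' i⟩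
  have := Ideal.mul_mem_left _ (b i ⊗ₜ[P] (1 : S)) (Ideal.mem_map_of_mem
    (Algebra.TensorProduct.includeRight : S →ₐ[P] Λ ⊗[P] S).toRingHom hi)
  convert this using 1
  change _ = b i ⊗ₜ[P] (1 : S) * (1 : Λ) ⊗ₜ[P] c i
  rw [Algebra.TensorProduct.tmul_mul_tmul, mul_one, one_mul]

theorem Ideal.nilradical_le_map_of_ringEquiv {X Y X' Y' : Type*} [CommRing X] [CommRing Y]
    [CommRing X'] [CommRing Y'] (α : X ≃+* X') (β : Y ≃+* Y') (u : X →+* Y) (u' : X' →+* Y')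
    (hcomm : ∀ x, β (u x) = u' (α x)) (h : nilradical Y' ≤ (nilradical X').map u') :
    nilradical Y ≤ (nilradical X).map u := by
  intro y hy
  have h1 := Ideal.mem_map_of_mem β.symm.toRingHom (h (IsNilpotent.map hy β : IsNilpotent (β y)))
  have h2 : β.symm.toRingHom (β y) = y := β.symm_apply_apply y
  rw [h2, Ideal.map_map] at h1
  refine Ideal.map_le_iff_le_comap.2 (fun x' hx' => ?_) h1
  have hx : α.symm x' ∈ nilradical X := IsNilpotent.map hx' α.symm
  have := Ideal.mem_map_of_mem u hx
  rw [Ideal.mem_comap]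
  convert this using 1
  apply β.injective
  rw [hcomm, α.apply_symm_apply]
  exact β.apply_symm_apply _

/-- `Λ ⊗ R → Λ ⊗ R` induced by an algebra homomorphism in the first factor, as a ring
homomorphism. -/
noncomputable abbrev mapLeft {A L Λ : Type*} [CommRing A] [CommRing L] [CommRing Λ] [Algebra A L]
    [Algebra A Λ] (g : L →ₐ[A] Λ) (R : Type*) [CommRing R] [Algebra A R] : L ⊗[A] R →+* Λ ⊗[A] R :=
  (Algebra.TensorProduct.map g (AlgHom.id A R)).toRingHom

theorem mapLeft_toAlgHom_apply (A L Λ : Type*) {R : Type*} [CommRing A] [CommRing L] [CommRing Λ]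
    [CommRing R] [Algebra A L] [Algebra L Λ] [Algebra A Λ] [IsScalarTower A L Λ] [Algebra A R]
    (x : L ⊗[A] R) : mapLeft (IsScalarTower.toAlgHom A L Λ) R x =
      Algebra.TensorProduct.cancelBaseChange A L Λ Λ R (1 ⊗ₜ x) := by
  induction x with
  | zero => simp
  | add x y hx hy => rw [map_add, hx, hy, TensorProduct.tmul_add, map_add]
  | tmul c r =>
    rw [Algebra.TensorProduct.cancelBaseChange_tmul, Algebra.smul_def, mul_one]
    rfl


/-- Let `P` be a perfect closure of the residue field of `A` at a prime. A large enough power of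
Frobenius kills the nilpotents of `P ⊗ R`, and over each field which contains the `p ^ e`-th roots
of `A` all nilpotents of the base changes of `R` to field extensions are already defined. -/
theorem exists_forall_nilradical_le {A R P : Type*} [CommRing A] [CommRing R] [Algebra A R]
    [Algebra.FiniteType A R] [Field P] [CharP P p] [PerfectRing P p] [Algebra A P]
    (hP : ∀ c : P, ∃ (n : ℕ) (a s : A), algebraMap A P s ≠ 0 ∧
      c ^ p ^ n * algebraMap A P s = algebraMap A P a) :
    ∃ e₀ : ℕ, ∀ e ≥ e₀, (∀ x : P ⊗[A] R, IsNilpotent x → x ^ p ^ e = 0) ∧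
      ∀ (L Λ : Type u) [Field L] [Field Λ] [Algebra A L] [Algebra L Λ] [Algebra A Λ]
        [IsScalarTower A L Λ] (_ : P →ₐ[A] Λ), (∀ a : A, ∃ b : L, b ^ p ^ e = algebraMap A L a) →
        nilradical (Λ ⊗[A] R) ≤
          (nilradical (L ⊗[A] R)).map (mapLeft (IsScalarTower.toAlgHom A L Λ) R) := by
  have hp : p.Prime := Fact.out
  have : IsNoetherianRing (P ⊗[A] R) := Algebra.FiniteType.isNoetherianRing P _
  obtain ⟨G, hG⟩ := (IsNoetherian.noetherian (nilradical (P ⊗[A] R)) : Submodule.FG _)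
  obtain ⟨k, hk⟩ := IsNoetherianRing.isNilpotent_nilradical (P ⊗[A] R)
  have hdesc : ∀ y : P ⊗[A] R, ∃ e₁ : ℕ, ∀ e ≥ e₁,
      ∀ (L Λ : Type u) [Field L] [Field Λ] [Algebra A L] [Algebra L Λ] [Algebra A Λ]
        [IsScalarTower A L Λ] (g : P →ₐ[A] Λ), (∀ a : A, ∃ b : L, b ^ p ^ e = algebraMap A L a) →
        ∃ x : L ⊗[A] R, mapLeft (IsScalarTower.toAlgHom A L Λ) R x = mapLeft g R y := by
    intro y
    induction y with
    | zero => exact ⟨0, fun e _ L Λ _ _ _ _ _ _ g _ => ⟨0, by simp only [map_zero]⟩⟩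
    | add y₁ y₂ h₁ h₂ =>
      obtain ⟨e₁, h₁⟩ := h₁
      obtain ⟨e₂, h₂⟩ := h₂
      refine ⟨max e₁ e₂, fun e he L Λ _ _ _ _ _ _ g hL => ?_⟩
      obtain ⟨x₁, hx₁⟩ := h₁ e (le_of_max_le_left he) L Λ g hL
      obtain ⟨x₂, hx₂⟩ := h₂ e (le_of_max_le_right he) L Λ g hL
      exact ⟨x₁ + x₂, by rw [map_add, map_add, hx₁, hx₂]⟩
    | tmul c r =>
      obtain ⟨n, a, s, hs, hc⟩ := hP c
      refine ⟨n, fun e he L Λ _ _ _ _ _ _ g hL => ?_⟩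
      obtain ⟨b₁, hb₁⟩ := hL a
      obtain ⟨b₂, hb₂⟩ := hL s
      -- As `b₁ / b₂` is a `p ^ e`-th root of `a / s`, this power is a `p ^ n`-th root of it. In `Λ`
      -- such a root is unique, hence equal to `g c`.
      refine ⟨((b₁ / b₂) ^ p ^ (e - n)) ⊗ₜ r, ?_⟩
      have hchar : CharP Λ p := charP_of_injective_ringHom g.toRingHom.injective p
      have hs' : algebraMap A Λ s ≠ 0 := by
        rw [← g.commutes]
        exact (map_ne_zero_iff _ g.toRingHom.injective).2 hs
      have hgc : g c ^ p ^ n * algebraMap A Λ s = algebraMap A Λ a := by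
        rw [← g.commutes, ← g.commutes, ← hc, map_mul, map_pow]
      have : algebraMap L Λ ((b₁ / b₂) ^ p ^ (e - n)) = g c := by
        apply iterateFrobenius_inj Λ p n
        rw [iterateFrobenius_def, iterateFrobenius_def, ← map_pow, ← pow_mul, ← pow_add,
          Nat.sub_add_cancel he, div_pow, hb₁, hb₂, map_div₀, ← IsScalarTower.algebraMap_apply,
          ← IsScalarTower.algebraMap_apply, div_eq_iff hs', hgc]
      change algebraMap L Λ _ ⊗ₜ r = g c ⊗ₜ r
      rw [this]
  choose E hE using hdesc
  -- The bound `k` controls the nilpotency order, and `G.sup E` the fields of definition of the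
  -- generators.
  refine ⟨max k (G.sup E), fun e he => ⟨fun x hx => ?_, ?_⟩⟩
  · have hx' : x ^ k ∈ nilradical (P ⊗[A] R) ^ k := Ideal.pow_mem_pow (mem_nilradical.2 hx) k
    rw [hk] at hx'
    exact pow_eq_zero_of_le ((le_of_max_le_left he).trans (Nat.lt_pow_self hp.one_lt).le) hx'
  · intro L Λ _ _ _ _ _ _ g hL
    let _ : Algebra P Λ := g.toRingHom.toAlgebra
    have : IsScalarTower A P Λ := IsScalarTower.of_algebraMap_eq fun a => (g.commutes a).symm
    have h1 : nilradical (Λ ⊗[A] R) ≤ (nilradical (P ⊗[A] R)).map (mapLeft g R) := by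
      refine Ideal.nilradical_le_map_of_ringEquiv (RingEquiv.refl _)
        (Algebra.TensorProduct.cancelBaseChange A P Λ Λ R).symm.toRingEquiv _ _ (fun x => ?_)
        (nilradical_tensorProduct_le_of_perfectRing p P Λ (P ⊗[A] R))
      change _ = (1 : Λ) ⊗ₜ[P] x
      rw [AlgEquiv.coe_ringEquiv, AlgEquiv.symm_apply_eq]
      exact mapLeft_toAlgHom_apply A P Λ x
    refine h1.trans (Ideal.map_le_iff_le_comap.2 ?_)
    rw [← hG]
    refine Submodule.span_le.2 fun y hy => ?_
    obtain ⟨x, hx⟩ := hE y e ((Finset.le_sup hy).trans (le_of_max_le_right he)) L Λ g hL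
    -- Injectivity makes the descended element nilpotent already over `L`.
    have hinj : Function.Injective (mapLeft (IsScalarTower.toAlgHom A L Λ) R) := by
      intro x y hxy
      rw [mapLeft_toAlgHom_apply, mapLeft_toAlgHom_apply] at hxy
      exact Algebra.TensorProduct.includeRight_injective (algebraMap L Λ).injective
        ((Algebra.TensorProduct.cancelBaseChange A L Λ Λ R).injective hxy)
    have hyn : IsNilpotent y := mem_nilradical.1 (hG ▸ Submodule.subset_span hy)
    have hxn : IsNilpotent x :=
      (IsNilpotent.map_iff hinj).1 (hx ▸ hyn.map (mapLeft g R))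
    change mapLeft g R y ∈ Ideal.map _ _
    rw [← hx]
    exact Ideal.mem_map_of_mem _ (mem_nilradical.2 hxn)

/-- Right exactness of the tensor product. -/
theorem ker_map_reduction (B Λ T : Type*) [CommRing B] [CommRing Λ] [CommRing T] [Algebra B Λ]
    [Algebra B T] :
    RingHom.ker (Algebra.TensorProduct.map (AlgHom.id Λ Λ) (Ideal.Quotient.mkₐ B (nilradical T))) =
      (nilradical T).map (Algebra.TensorProduct.includeRight : T →ₐ[B] Λ ⊗[B] T).toRingHom := by
  have h := Algebra.TensorProduct.lTensor_ker (A := Λ) (Ideal.Quotient.mkₐ B (nilradical T))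
    (Ideal.Quotient.mkₐ_surjective B _)
  have hk : RingHom.ker (Ideal.Quotient.mkₐ B (nilradical T)) = nilradical T := Ideal.mk_ker
  rw [hk] at h
  exact h

theorem map_reduction_surjective (B Λ T : Type*) [CommRing B] [CommRing Λ] [CommRing T]
    [Algebra B Λ] [Algebra B T] : Function.Surjective
      (Algebra.TensorProduct.map (AlgHom.id Λ Λ) (Ideal.Quotient.mkₐ B (nilradical T))) := by
  intro z
  induction z with
  | zero => exact ⟨0, map_zero _⟩
  | add x y hx hy =>
    obtain ⟨x, rfl⟩ := hx
    obtain ⟨y, rfl⟩ := hy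
    exact ⟨x + y, map_add _ _ _⟩
  | tmul l t =>
    obtain ⟨t, rfl⟩ := Ideal.Quotient.mk_surjective t
    exact ⟨l ⊗ₜ t, rfl⟩

/-- The reduction of `B ⊗ R` becomes geometrically reduced over `L`, if all nilpotents of
`AlgebraicClosure L ⊗ R` are defined over `L`. -/
theorem isGeometricallyReduced_tensorProduct_reduction {A R B L : Type*} [CommRing A] [CommRing R]
    [CommRing B] [Field L] [Algebra A R] [Algebra A B] [Algebra B L] [Algebra A L]
    [IsScalarTower A B L] (hBL : IsFractionsModNil B L)
    (hnil : nilradical (AlgebraicClosure L ⊗[A] R) ≤ (nilradical (L ⊗[A] R)).map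
      (mapLeft (IsScalarTower.toAlgHom A L (AlgebraicClosure L)) R)) :
    Algebra.IsGeometricallyReduced L (L ⊗[B] Reduction (B ⊗[A] R)) := by
  rw [Algebra.isGeometricallyReduced_field_iff]
  let Λ := AlgebraicClosure L
  let T := B ⊗[A] R
  let q : Λ ⊗[B] T →ₐ[Λ] Λ ⊗[B] Reduction T :=
    Algebra.TensorProduct.map (AlgHom.id Λ Λ) (Ideal.Quotient.mkₐ B (nilradical T))
  let incl : T →+* Λ ⊗[B] T := (Algebra.TensorProduct.includeRight : T →ₐ[B] Λ ⊗[B] T).toRingHom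
  have hq : RingHom.ker q = (nilradical T).map incl := ker_map_reduction B Λ T
  have hqs : Function.Surjective q := map_reduction_surjective B Λ T
  have h1 : nilradical (Λ ⊗[B] T) ≤ (nilradical (L ⊗[B] T)).map
      (mapLeft (IsScalarTower.toAlgHom B L Λ) T) := by
    refine Ideal.nilradical_le_map_of_ringEquiv
      (Algebra.TensorProduct.cancelBaseChange A B L L R).toRingEquiv
      (Algebra.TensorProduct.cancelBaseChange A B Λ Λ R).toRingEquiv _ _ (fun x => ?_) hnil
    induction x with
    | zero => simp only [map_zero]
    | add x y hx hy => simp only [map_add, hx, hy]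
    | tmul l t =>
      induction t with
      | zero => simp only [TensorProduct.tmul_zero, map_zero]
      | add x y hx hy => simp only [TensorProduct.tmul_add, map_add, hx, hy]
      | tmul b r =>
        change (b • algebraMap L Λ l) ⊗ₜ[A] r = algebraMap L Λ (b • l) ⊗ₜ[A] r
        exact congr_arg (· ⊗ₜ[A] r) ((Algebra.linearMap L Λ).map_smul_of_tower b l).symm
  -- The nilpotents descend from `Λ` to `L` by hypothesis, and from `L` to `T` because `L` consists
  -- of fractions modulo nilpotents. So the kernel of `q` contains all nilpotents.
  have h2 : nilradical (Λ ⊗[B] T) ≤ (nilradical T).map incl := by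
    refine h1.trans ((Ideal.map_mono (hBL.nilradical_tensorProduct_le T)).trans ?_)
    rw [Ideal.map_map]
    refine le_of_eq (congr_arg (fun f => Ideal.map f (nilradical T)) (RingHom.ext fun t => ?_))
    change algebraMap L Λ 1 ⊗ₜ[B] t = 1 ⊗ₜ t
    rw [map_one]
  have hred : IsReduced (Λ ⊗[B] Reduction T) := by
    refine ⟨fun z hz => ?_⟩
    obtain ⟨w, rfl⟩ := hqs z
    obtain ⟨n, hn⟩ := hz
    have hw : IsNilpotent (w ^ n) := by
      have h3 : (nilradical T).map incl ≤ nilradical (Λ ⊗[B] T) :=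
        Ideal.map_le_iff_le_comap.2 fun t ht => IsNilpotent.map ht incl
      refine h3 (hq ▸ ?_)
      rw [RingHom.mem_ker, map_pow, hn]
    obtain ⟨k, hk⟩ := hw
    have : w ∈ nilradical (Λ ⊗[B] T) := mem_nilradical.2 ⟨n * k, by rw [pow_mul, hk]⟩
    have := h2 this
    rwa [← hq] at this
  exact isReduced_of_injective
    (Algebra.TensorProduct.cancelBaseChange B L Λ Λ (Reduction T))
    (Algebra.TensorProduct.cancelBaseChange B L Λ Λ (Reduction T)).injective

/-- Reduction commutes with localization. -/
noncomputable def reductionEquiv {A R B B' : Type*} [CommRing A] [CommRing R]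
    [CommRing B] [CommRing B'] [Algebra A R] [Algebra A B] [Algebra B B'] [Algebra A B']
    [IsScalarTower A B B'] (h : IsFractionsModNil B B') :
    (B' ⊗[B] Reduction (B ⊗[A] R)) ≃ₗ[B'] Reduction (B' ⊗[A] R) :=
  let T := B ⊗[A] R
  let q : B' ⊗[B] T →ₐ[B'] B' ⊗[B] Reduction T :=
    Algebra.TensorProduct.map (AlgHom.id B' B') (Ideal.Quotient.mkₐ B (nilradical T))
  have hq : RingHom.ker q = nilradical (B' ⊗[B] T) := by
    rw [ker_map_reduction B B' T]
    refine le_antisymm ?_ (h.nilradical_tensorProduct_le T)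
    exact Ideal.map_le_iff_le_comap.2 fun t ht => IsNilpotent.map ht
      (Algebra.TensorProduct.includeRight : T →ₐ[B] B' ⊗[B] T)
  let c := Algebra.TensorProduct.cancelBaseChange A B B' B' R
  have hc : nilradical (B' ⊗[A] R) = (RingHom.ker q).map (c : B' ⊗[B] T →+* B' ⊗[A] R) := by
    rw [hq]
    refine le_antisymm (fun x hx => ?_) (Ideal.map_le_iff_le_comap.2 fun t ht => IsNilpotent.map ht c)
    have : c.symm x ∈ nilradical (B' ⊗[B] T) := IsNilpotent.map hx c.symm
    have := Ideal.mem_map_of_mem (c : B' ⊗[B] T →+* B' ⊗[A] R) this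
    convert this using 1
    exact (c.apply_symm_apply x).symm
  ((Ideal.quotientKerAlgEquivOfSurjective (map_reduction_surjective B B' T)).symm.trans
    (Ideal.quotientEquivAlg _ _ c hc)).toLinearEquiv

end Perfect

/-! ### From local to global regularity under flat Frobenius. -/

theorem CharP.of_ringHom_of_prime (p : ℕ) [hp : Fact p.Prime] {A B : Type*} [CommRing A]
    [CommRing B] [CharP A p] [Nontrivial B] (f : A →+* B) : CharP B p :=
  (CharP.charP_iff_prime_eq_zero hp.out).2 (by rw [← map_natCast f, CharP.cast_eq_zero, map_zero])

section FrobeniusFlat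

variable (p : ℕ) [Fact p.Prime]

theorem iterateFrobenius_flat {C : Type*} [CommRing C] [CharP C p] (h : (frobenius C p).Flat)
    (e : ℕ) : (iterateFrobenius C p e).Flat := by
  induction e with
  | zero =>
    rw [iterateFrobenius_zero]
    exact RingHom.Flat.id C
  | succ e ih =>
    have : iterateFrobenius C p (e + 1) = (frobenius C p).comp (iterateFrobenius C p e) :=
      RingHom.ext fun x => by
        rw [RingHom.comp_apply, iterateFrobenius_def, iterateFrobenius_def, frobenius_def, pow_succ,
          pow_mul]
    rw [this]
    exact RingHom.Flat.comp ih h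

theorem FrobeniusPushforward.flat {C : Type*} [CommRing C] [CharP C p]
    (h : (frobenius C p).Flat) (e : ℕ) : Module.Flat C (FrobeniusPushforward p e C) := by
  rw [← RingHom.flat_algebraMap_iff]
  exact RingHom.Flat.comp (f := iterateFrobenius C p e) (iterateFrobenius_flat p h e)
    (RingHom.Flat.of_bijective (f := (FrobeniusPushforward.of p e C).toRingHom)
      (FrobeniusPushforward.of p e C).bijective)

/-- A Noetherian ring with flat Frobenius is regular. -/
theorem IsRegularRing.of_flat_frobenius {C : Type*} [CommRing C] [CharP C p] [IsNoetherianRing C]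
    (h : (frobenius C p).Flat) : IsRegularRing C := by
  rw [isRegularRing_iff]
  intro P hP
  have : CharP (Localization.AtPrime P) p :=
    CharP.of_ringHom_of_prime p (algebraMap C _)
  -- Frobenius fixes every prime, so it localizes to an endomorphism of `C_P`, which is the
  -- Frobenius of `C_P`.
  have hcomap : P = P.comap (frobenius C p) := by
    ext x
    rw [Ideal.mem_comap, frobenius_def, hP.pow_mem_iff_mem p (Fact.out : p.Prime).pos]
  refine IsRegularLocalRing.of_flat_frobenius p (FrobeniusPushforward.flat p ?_)
  convert h.localRingHom P P hcomap
  refine IsLocalization.ringHom_ext P.primeCompl (RingHom.ext fun x => ?_)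
  rw [RingHom.comp_apply, RingHom.comp_apply, Localization.localRingHom_to_map, frobenius_def,
    frobenius_def, map_pow]

end FrobeniusFlat

/-! ### Perfect closures of residue fields and the exponent at one prime. -/

section PerfectClosure

variable (p : ℕ) [Fact p.Prime]

/-- The perfect closure of the residue field at a prime. -/
theorem exists_perfect_extension {A : Type u} [CommRing A] [CharP A p] (I : Ideal A) [I.IsPrime] :
    ∃ (P : Type u) (_ : Field P) (_ : CharP P p) (_ : PerfectRing P p) (_ : Algebra A P),
      (∀ a, algebraMap A P a = 0 ↔ a ∈ I) ∧
      (∀ c : P, ∃ (n : ℕ) (a s : A), algebraMap A P s ≠ 0 ∧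
        c ^ p ^ n * algebraMap A P s = algebraMap A P a) ∧
      Nonempty (I.ResidueField →ₐ[A] P) ∧
      ∀ (Λ : Type u) [Field Λ] [CharP Λ p] [PerfectRing Λ p] [Algebra A Λ],
        (∀ a, algebraMap A Λ a = 0 ↔ a ∈ I) → Nonempty (P →ₐ[A] Λ) := by
  let K := I.ResidueField
  have : CharP K p := CharP.of_ringHom_of_prime p (algebraMap A K)
  let P := PerfectClosure K p
  let φ : K →+* P := PerfectClosure.of K p
  let _ : Algebra A P := (φ.comp (algebraMap A K)).toAlgebra
  have hmap : ∀ a, algebraMap A P a = φ (algebraMap A K a) := fun _ => rfl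
  have h0 : ∀ a, algebraMap A P a = 0 ↔ a ∈ I := fun a => by
    rw [hmap, map_eq_zero_iff φ φ.injective, Ideal.algebraMap_residueField_eq_zero]
  refine ⟨P, inferInstance, inferInstance, inferInstance, inferInstance, h0, fun c => ?_,
    ⟨{ φ with commutes' := fun _ => rfl }⟩, ?_⟩
  · obtain ⟨⟨n, k⟩, rfl⟩ := PerfectClosure.mk_surjective K p c
    have hc : PerfectClosure.mk K p (n, k) ^ p ^ n = φ k := by
      rw [← iterateFrobenius_def, coe_iterateFrobenius, PerfectClosure.iterate_frobenius_mk]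
    obtain ⟨x, y, hy, hxy⟩ := IsFractionRing.div_surjective (A := A ⧸ I) k
    obtain ⟨a, rfl⟩ := Ideal.Quotient.mk_surjective x
    obtain ⟨s, rfl⟩ := Ideal.Quotient.mk_surjective y
    have hs : algebraMap A P s ≠ 0 := fun h => nonZeroDivisors.ne_zero hy
      (Ideal.Quotient.eq_zero_iff_mem.2 ((h0 s).1 h))
    refine ⟨n, a, s, hs, ?_⟩
    have hs' : algebraMap A K s ≠ 0 := fun h => hs (by rw [hmap, h, map_zero])
    rw [Ideal.algebraMap_quotient_residueField_mk, Ideal.algebraMap_quotient_residueField_mk,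
      div_eq_iff hs'] at hxy
    rw [hc, hmap, hmap, hxy, map_mul]
  · intro Λ _ _ _ _ hΛ
    let ψ : K →+* Λ := Ideal.ResidueField.lift I (algebraMap A Λ) (fun a ha => (hΛ a).2 ha)
      (fun a ha => isUnit_iff_ne_zero.2 fun h => ha ((hΛ a).1 h))
    refine ⟨{ PerfectClosure.lift K p Λ ψ with commutes' := fun a => ?_ }⟩
    have h1 : PerfectClosure.lift K p Λ ψ (φ (algebraMap A K a)) = ψ (algebraMap A K a) :=
      RingHom.congr_fun ((PerfectClosure.lift K p Λ).symm_apply_apply ψ) _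
    exact h1.trans (Ideal.ResidueField.lift_algebraMap _ _ _ _ a)

/-- The exponent beyond which the reduction of `L ⊗ R` is geometrically reduced, at one prime. -/
theorem exists_exponent {A : Type u} {R : Type*} [CommRing A] [CommRing R] [CharP A p]
    [Algebra A R] [Algebra.FiniteType A R] (I : Ideal A) [I.IsPrime] :
    ∃ (P : Type u) (_ : Field P) (_ : CharP P p) (_ : PerfectRing P p) (_ : Algebra A P),
      (∀ a, algebraMap A P a = 0 ↔ a ∈ I) ∧ Nonempty (I.ResidueField →ₐ[A] P) ∧
      ∃ e₀ : ℕ, ∀ e ≥ e₀, (∀ x : P ⊗[A] R, IsNilpotent x → x ^ p ^ e = 0) ∧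
        ∀ (L : Type u) [Field L] [Algebra A L], (∀ a, algebraMap A L a = 0 ↔ a ∈ I) →
          (∀ a : A, ∃ b : L, b ^ p ^ e = algebraMap A L a) →
          nilradical (AlgebraicClosure L ⊗[A] R) ≤ (nilradical (L ⊗[A] R)).map
            (mapLeft (IsScalarTower.toAlgHom A L (AlgebraicClosure L)) R) := by
  obtain ⟨P, _, _, _, _, h0, hP, hκ, hlift⟩ := exists_perfect_extension p I
  obtain ⟨e₀, he₀⟩ := exists_forall_nilradical_le.{u} p (A := A) (R := R) hP
  refine ⟨P, inferInstance, inferInstance, inferInstance, inferInstance, h0, hκ, e₀,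
    fun e he => ⟨(he₀ e he).1, fun L _ _ hL hroots => ?_⟩⟩
  have hmap : ∀ a, algebraMap A (AlgebraicClosure L) a = 0 ↔ a ∈ I := fun a => by
    rw [IsScalarTower.algebraMap_apply A L (AlgebraicClosure L),
      map_eq_zero_iff _ (algebraMap L (AlgebraicClosure L)).injective, hL]
  have : CharP (AlgebraicClosure L) p :=
    CharP.of_ringHom_of_prime p (algebraMap A _)
  have : PerfectRing (AlgebraicClosure L) p := PerfectField.toPerfectRing p
  obtain ⟨g⟩ := hlift (AlgebraicClosure L) hmap
  exact (he₀ e he).2 L (AlgebraicClosure L) g hroots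

end PerfectClosure

/-! ### Residue fields of minimal primes and localizations as fractions modulo nilpotents. -/

section Fractions

/-- If no multiple of `b ∈ I` by an element outside `I` were nilpotent, a prime would avoid both `b`
and the complement of `I`. It would be strictly smaller than the minimal prime `I`. -/
theorem IsFractionsModNil.of_minimalPrimes {B : Type*} [CommRing B] (I : Ideal B) [I.IsPrime]
    (hI : I ∈ minimalPrimes B) : IsFractionsModNil B I.ResidueField where
  surj l := by
    obtain ⟨x, y, hy, rfl⟩ := IsFractionRing.div_surjective (A := B ⧸ I) l
    obtain ⟨b, rfl⟩ := Ideal.Quotient.mk_surjective x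
    obtain ⟨s, rfl⟩ := Ideal.Quotient.mk_surjective y
    have hs : algebraMap B I.ResidueField s ≠ 0 := fun h => nonZeroDivisors.ne_zero hy
      (Ideal.Quotient.eq_zero_iff_mem.2 (Ideal.algebraMap_residueField_eq_zero.1 h))
    exact ⟨b, s, isUnit_iff_ne_zero.2 hs, mul_div_cancel₀ _ hs⟩
  nil b hb := by
    rw [Ideal.algebraMap_residueField_eq_zero] at hb
    obtain ⟨s, hs, n, hn⟩ : ∃ s ∉ I, IsNilpotent (s * b) := by
      by_contra! hcon
      have hdisj : Disjoint ((⊥ : Ideal B) : Set B)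
          (I.primeCompl ⊔ Submonoid.powers b : Submonoid B) := by
        rw [Set.disjoint_left]
        rintro x hx hxM
        obtain ⟨s, hs, y, ⟨n, rfl⟩, hsy⟩ := Submonoid.mem_sup.1 hxM
        rw [Submodule.bot_coe, Set.mem_singleton_iff] at hx
        refine hcon s hs ⟨n + 1, ?_⟩
        have : (s * b) ^ (n + 1) = s ^ n * b * (s * b ^ n) := by ring
        rw [this]
        exact mul_eq_zero_of_right _ (hsy.trans hx)
      obtain ⟨J, hJ, -, hJd⟩ := Ideal.exists_le_prime_disjoint _ _ hdisj
      have hJI : J ≤ I := fun x hx => by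
        by_contra hxI
        exact Set.disjoint_left.1 hJd hx (Submonoid.mem_sup_left (show x ∈ I.primeCompl from hxI))
      exact Set.disjoint_left.1 hJd (hI.2 ⟨hJ, bot_le⟩ hJI hb)
        (Submonoid.mem_sup_right (Submonoid.mem_powers b))
    exact ⟨s, isUnit_iff_ne_zero.2 fun h => hs (Ideal.algebraMap_residueField_eq_zero.1 h), n, hn⟩

theorem IsFractionsModNil.of_isLocalization {B L : Type*} [CommRing B] [CommRing L] [Algebra B L]
    (M : Submonoid B) [IsLocalization M L] : IsFractionsModNil B L where
  surj l := by
    obtain ⟨⟨b, s⟩, h⟩ := IsLocalization.surj M l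
    exact ⟨b, s, IsLocalization.map_units L s, by rw [mul_comm]; exact h⟩
  nil b hb := by
    obtain ⟨s, hs⟩ := (IsLocalization.map_eq_zero_iff M L b).1 hb
    exact ⟨s, IsLocalization.map_units L s, by rw [hs]; exact IsNilpotent.zero⟩

end Fractions

/-! ### Generic freeness of base changes and of their reductions. -/

section GenericFreeness

/-- Generic freeness of the reduction of `B ⊗ R`, in all localizations inverting one element. -/
theorem exists_forall_free_reduction {A R B : Type*} [CommRing A] [CommRing R] [CommRing B]
    [IsDomain B] [Algebra A R] [Algebra.FiniteType A R] [Algebra A B] :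
    ∃ h : B, h ≠ 0 ∧ ∀ (B' : Type*) [CommRing B'] [Algebra B B'] [Algebra A B']
      [IsScalarTower A B B'] [Module.Flat B B'], IsFractionsModNil B B' →
      IsUnit (algebraMap B B' h) → Module.Free B' (Reduction (B' ⊗[A] R)) := by
  have : Algebra.FiniteType B (Reduction (B ⊗[A] R)) :=
    Algebra.FiniteType.of_surjective (Ideal.Quotient.mkₐ B _) (Ideal.Quotient.mkₐ_surjective B _)
  obtain ⟨h, hh, hfree⟩ := Algebra.FiniteType.exists_forall_free_tensorProduct B
    (Reduction (B ⊗[A] R))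
  refine ⟨h, hh, fun B' _ _ _ _ _ hB' hu => ?_⟩
  have := hfree B' hu
  exact Module.Free.of_equiv (reductionEquiv hB')

theorem exists_forall_free_tensorProduct' {A R D : Type*} [CommRing A] [CommRing R] [CommRing D]
    [IsDomain D] [Algebra A R] [Algebra.FiniteType A R] [Algebra A D] :
    ∃ h : D, h ≠ 0 ∧ ∀ (D' : Type*) [CommRing D'] [Algebra D D'] [Algebra A D']
      [IsScalarTower A D D'] [Module.Flat D D'],
      IsUnit (algebraMap D D' h) → Module.Free D' (D' ⊗[A] R) := by
  obtain ⟨h, hh, hfree⟩ := Algebra.FiniteType.exists_forall_free_tensorProduct D (D ⊗[A] R)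
  refine ⟨h, hh, fun D' _ _ _ _ _ hu => ?_⟩
  have := hfree D' hu
  exact Module.Free.of_equiv (Algebra.TensorProduct.cancelBaseChange A D D' D' R).toLinearEquiv

end GenericFreeness

/-! ### Generic regularity of domains with finite Frobenius. -/

section FrobeniusLocalization

variable (p : ℕ) [Fact p.Prime]

/-- The Frobenius of a localization is the base change of the Frobenius. -/
theorem frobenius_flat_of_tensorProduct {D D' : Type*} [CommRing D] [CommRing D'] [CharP D p]
    [CharP D' p] [Algebra D D'] (hinj : Function.Injective (algebraMap D D'))
    (hD' : IsFractionsModNil D D') (hflat : Module.Flat D' (D' ⊗[D] FrobeniusPushforward p 1 D)) :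
    (frobenius D' p).Flat := by
  let F := FrobeniusPushforward p 1 D
  let F' := FrobeniusPushforward p 1 D'
  have : IsScalarTower D D' F' := IsScalarTower.of_algebraMap_eq fun a => rfl
  let j : F →ₐ[D] F' :=
    { ((FrobeniusPushforward.of p 1 D').toRingHom.comp (algebraMap D D')).comp
        (FrobeniusPushforward.of p 1 D).symm.toRingHom with
      commutes' := fun a => congr_arg (FrobeniusPushforward.of p 1 D') (map_pow _ a (p ^ 1)) }
  have hj : ∀ d, j (FrobeniusPushforward.of p 1 D d) =
    FrobeniusPushforward.of p 1 D' (algebraMap D D' d) := fun _ => rfl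
  let Ψ : D' ⊗[D] F →ₐ[D'] F' := Algebra.TensorProduct.lift (Algebra.ofId D' F') j
    fun _ _ => Commute.all _ _
  have hΨ : ∀ (l : D') (d : F), Ψ (l ⊗ₜ d) = algebraMap D' F' l * j d := fun _ _ =>
    Algebra.TensorProduct.lift_tmul _ _ _ _ _
  have hΨi : Function.Injective Ψ := by
    rw [injective_iff_map_eq_zero]
    intro z hz
    obtain ⟨s, t, hs, hst⟩ := hD'.exists_smul_tmul z
    obtain ⟨d, rfl⟩ := (FrobeniusPushforward.of p 1 D).surjective t
    have h1 : Ψ (s • z) = 0 := by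
      rw [Algebra.smul_def, map_mul, hz, mul_zero]
    rw [hst, hΨ, map_one, one_mul, hj, map_eq_zero_iff _ (RingEquiv.injective _),
      map_eq_zero_iff _ hinj] at h1
    rw [h1, map_zero, TensorProduct.tmul_zero, Algebra.smul_def] at hst
    have hu : IsUnit (algebraMap D (D' ⊗[D] F) s) := by
      rw [IsScalarTower.algebraMap_apply D D' (D' ⊗[D] F)]
      exact hs.map _
    exact (hu.mul_right_eq_zero).1 hst
  have hΨs : Function.Surjective Ψ := by
    intro y
    obtain ⟨l, rfl⟩ := (FrobeniusPushforward.of p 1 D').surjective y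
    obtain ⟨d, s, hs, hl⟩ := hD'.surj l
    obtain ⟨u, hu⟩ := hs.exists_left_inv
    -- Since `D'` acts through `p`-th powers, the fraction `d / s` is rewritten as `d * s ^ (p - 1)
    -- / s ^ p`.
    refine ⟨u ⊗ₜ FrobeniusPushforward.of p 1 D (d * s ^ (p - 1)), ?_⟩
    rw [hΨ, hj, FrobeniusPushforward.algebraMap_apply, ← map_mul]
    congr 1
    have hp : p = (p - 1) + 1 := (Nat.sub_add_cancel (Fact.out : p.Prime).one_le).symm
    change u ^ p ^ 1 * _ = l
    rw [map_mul, ← hl, map_pow, pow_one]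
    conv_lhs => rw [hp]
    rw [Nat.add_sub_cancel]
    calc u ^ (p - 1 + 1) * (algebraMap D D' s * l * algebraMap D D' s ^ (p - 1))
        = (u * algebraMap D D' s) ^ (p - 1 + 1) * l := by ring
      _ = l := by rw [hu, one_pow, one_mul]
  have hF' : Module.Flat D' F' :=
    Module.Flat.of_linearEquiv (LinearEquiv.ofBijective Ψ.toLinearMap ⟨hΨi, hΨs⟩).symm
  rw [← RingHom.flat_algebraMap_iff] at hF'
  have h2 := RingHom.Flat.comp hF' (RingHom.Flat.of_bijective
    (f := (FrobeniusPushforward.of p 1 D').symm.toRingHom)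
    (FrobeniusPushforward.of p 1 D').symm.bijective)
  convert h2
  ext x
  change x ^ p = x ^ p ^ 1
  rw [pow_one]

/-- A domain with finite Frobenius is regular after inverting one element. -/
theorem exists_forall_isRegularRing {D : Type*} [CommRing D] [IsDomain D] [CharP D p]
    (hD : (frobenius D p).Finite) :
    ∃ h : D, h ≠ 0 ∧ ∀ (D' : Type*) [CommRing D'] [IsNoetherianRing D'] [CharP D' p]
      [Algebra D D'] [Module.Flat D D'], Function.Injective (algebraMap D D') →
      IsFractionsModNil D D' → IsUnit (algebraMap D D' h) → IsRegularRing D' := by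
  have : Algebra.FiniteType D (FrobeniusPushforward p 1 D) := by
    have h1 := RingHom.Finite.comp (RingHom.Finite.of_surjective
      (FrobeniusPushforward.of p 1 D).toRingHom (FrobeniusPushforward.of p 1 D).surjective) hD
    have h2 : (FrobeniusPushforward.of p 1 D).toRingHom.comp (frobenius D p) =
        algebraMap D (FrobeniusPushforward p 1 D) := by
      ext x
      change x ^ p = x ^ p ^ 1
      rw [pow_one]
    rw [h2] at h1
    exact RingHom.finiteType_algebraMap.1 h1.finiteType
  obtain ⟨h, hh, hfree⟩ := Algebra.FiniteType.exists_forall_free_tensorProduct D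
    (FrobeniusPushforward p 1 D)
  refine ⟨h, hh, fun D' _ _ _ _ _ hinj hD' hu => ?_⟩
  have := hfree D' hu
  exact IsRegularRing.of_flat_frobenius p (frobenius_flat_of_tensorProduct p hinj hD' inferInstance)

end FrobeniusLocalization

/-! ### The relative Frobenius and its vanishing on nilpotents. -/

section RelativeFrobenius

variable (p e : ℕ) [Fact p.Prime]

/-- The structure of an `F^e_* D`-algebra on `F^e_* D'` induced by a `D`-algebra `D'`. -/
noncomputable abbrev FrobeniusPushforward.mapAlgebra (D D' : Type*) [CommRing D] [CommRing D']
    [Algebra D D'] : Algebra (FrobeniusPushforward p e D) (FrobeniusPushforward p e D') :=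
  (((FrobeniusPushforward.of p e D').toRingHom.comp (algebraMap D D')).comp
    (FrobeniusPushforward.of p e D).symm.toRingHom).toAlgebra

variable {A C R Y : Type*} [CommRing A] [CommRing C] [CommRing R] [CommRing Y] [CharP C p]
  [CharP Y p] [Algebra A C] [Algebra A R] [Algebra A Y]

/-- The relative Frobenius `F^e_* C ⊗ R → F^e_* Y`, for `A`-algebra homomorphisms from `C` and `R`
to `Y`. -/
noncomputable def relativeFrobenius (u : C →ₐ[A] Y) (v : R →ₐ[A] Y) :
    FrobeniusPushforward p e C ⊗[A] R →ₐ[A] FrobeniusPushforward p e Y :=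
  Algebra.TensorProduct.lift
    { ((FrobeniusPushforward.of p e Y).toRingHom.comp u.toRingHom).comp
        (FrobeniusPushforward.of p e C).symm.toRingHom with
      commutes' := fun a => congr_arg (FrobeniusPushforward.of p e Y)
        ((map_pow u _ _).trans (congr_arg (· ^ p ^ e) (u.commutes a))) }
    { ((FrobeniusPushforward.of p e Y).toRingHom.comp (iterateFrobenius Y p e)).comp v.toRingHom with
      commutes' := fun a => congr_arg (fun y => FrobeniusPushforward.of p e Y (y ^ p ^ e))
        (v.commutes a) }
    fun _ _ => Commute.all _ _

theorem relativeFrobenius_tmul (u : C →ₐ[A] Y) (v : R →ₐ[A] Y) (c : C) (r : R) :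
    relativeFrobenius p e u v (FrobeniusPushforward.of p e C c ⊗ₜ r) =
      FrobeniusPushforward.of p e Y (u c * v r ^ p ^ e) :=
  (Algebra.TensorProduct.lift_tmul _ _ _ _ _).trans
    (map_mul (FrobeniusPushforward.of p e Y) _ _).symm

variable {P : Type*} [Field P] [CharP P p] [PerfectRing P p] [Algebra A P]

/-- The extraction of `p ^ e`-th roots in a perfect field. -/
noncomputable def FrobeniusPushforward.root (g : C →ₐ[A] P) : FrobeniusPushforward p e C →ₐ[A] P :=
  { ((iterateFrobeniusEquiv P p e).symm.toRingHom.comp g.toRingHom).comp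
      (FrobeniusPushforward.of p e C).symm.toRingHom with
    commutes' := fun a => by
      change (iterateFrobeniusEquiv P p e).symm (g (algebraMap A C a ^ p ^ e)) = _
      rw [RingEquiv.symm_apply_eq, map_pow, g.commutes]
      rfl }

theorem FrobeniusPushforward.root_of_pow (g : C →ₐ[A] P) (c : C) :
    FrobeniusPushforward.root p e g (FrobeniusPushforward.of p e C c) ^ p ^ e = g c :=
  (iterateFrobeniusEquiv P p e).apply_symm_apply (g c)

/-- After embedding `Y` into `P ⊗ R`, the relative Frobenius becomes `z ↦ j z ^ p ^ e`, where `j`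
extracts roots in `P`. A nilpotent `z` has nilpotent image `j z`, whose `p ^ e`-th power is zero. -/
theorem relativeFrobenius_eq_zero (u : C →ₐ[A] Y) (v : R →ₐ[A] Y) (g : C →ₐ[A] P)
    (W : Y →ₐ[A] P ⊗[A] R) (hW : Function.Injective W) (hWu : ∀ c, W (u c) = g c ⊗ₜ 1)
    (hWv : ∀ r, W (v r) = 1 ⊗ₜ r) (hnil : ∀ x : P ⊗[A] R, IsNilpotent x → x ^ p ^ e = 0)
    {n : FrobeniusPushforward p e C ⊗[A] R} (hn : IsNilpotent n) :
    relativeFrobenius p e u v n = 0 := by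
  rcases subsingleton_or_nontrivial (P ⊗[A] R) with hs | hs
  · have : Subsingleton Y := hW.subsingleton
    exact (FrobeniusPushforward.of p e Y).symm.injective (Subsingleton.elim _ _)
  have : CharP (P ⊗[A] R) p := CharP.of_ringHom_of_prime p (algebraMap P (P ⊗[A] R))
  let j : FrobeniusPushforward p e C ⊗[A] R →ₐ[A] P ⊗[A] R :=
    Algebra.TensorProduct.map (FrobeniusPushforward.root p e g) (AlgHom.id A R)
  have key : ∀ z, W ((FrobeniusPushforward.of p e Y).symm (relativeFrobenius p e u v z)) =
      iterateFrobenius (P ⊗[A] R) p e (j z) := by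
    intro z
    induction z with
    | zero => simp only [map_zero]
    | add x y hx hy => simp only [map_add, hx, hy]
    | tmul c r =>
      obtain ⟨c, rfl⟩ := (FrobeniusPushforward.of p e C).surjective c
      rw [relativeFrobenius_tmul, RingEquiv.symm_apply_apply, map_mul, map_pow, hWu, hWv,
        Algebra.TensorProduct.map_tmul, iterateFrobenius_def, Algebra.TensorProduct.tmul_pow,
        Algebra.TensorProduct.tmul_pow, FrobeniusPushforward.root_of_pow,
        Algebra.TensorProduct.tmul_mul_tmul, one_pow, one_mul, mul_one]
      rfl
  apply (FrobeniusPushforward.of p e Y).symm.injective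
  apply hW
  rw [key, iterateFrobenius_def, hnil _ (hn.map j), map_zero, map_zero]

end RelativeFrobenius

/-! ### Minimal primes with regular local ring. -/

section Minimal

/-- The local ring at `I` is regular of dimension zero, so its maximal ideal vanishes and each
element of `I` is killed by something outside `I`. A product over finitely many generators kills all
of `I`. -/
theorem exists_mul_eq_zero_of_regular {A : Type*} [CommRing A] [IsNoetherianRing A] (I : Ideal A)
    [I.IsPrime] (hI : I ∈ minimalPrimes A)
    (hreg : IsRegularLocalRing (Localization.AtPrime I)) :
    ∃ s ∉ I, ∀ a ∈ I, s * a = 0 := by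
  classical
  have hdim : ringKrullDim (Localization.AtPrime I) = 0 := by
    rw [IsLocalization.AtPrime.ringKrullDim_eq_height I]
    rw [Ideal.height_eq_zero_iff.2 hI]
    rfl
  have hbot : IsLocalRing.maximalIdeal (Localization.AtPrime I) = ⊥ := by
    have h1 := hreg.spanFinrank_maximalIdeal
    rw [hdim] at h1
    exact (Submodule.spanFinrank_eq_zero_iff_eq_bot (IsNoetherian.noetherian _)).1
      (by exact_mod_cast h1)
  have hloc : ∀ a ∈ I, ∃ s ∉ I, s * a = 0 := fun a ha => by
    have h1 : algebraMap A (Localization.AtPrime I) a = 0 := by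
      rw [← Submodule.mem_bot (R := Localization.AtPrime I), ← hbot]
      exact (IsLocalization.AtPrime.to_map_mem_maximal_iff _ I a).2 ha
    obtain ⟨s, hs⟩ := (IsLocalization.map_eq_zero_iff I.primeCompl _ a).1 h1
    exact ⟨s, s.2, hs⟩
  obtain ⟨G, hG⟩ := (IsNoetherian.noetherian I : Submodule.FG I)
  choose! t ht ht0 using hloc
  have hGI : ∀ g ∈ G, g ∈ I := fun g hg => hG ▸ Submodule.subset_span hg
  refine ⟨∏ g ∈ G, t g, fun h => ?_, fun a ha => ?_⟩
  · obtain ⟨g, hg, hgt⟩ := (Ideal.IsPrime.prod_mem_iff).1 h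
    exact ht g (hGI g hg) hgt
  · have hle : I ≤ LinearMap.ker (LinearMap.mulLeft A (∏ g ∈ G, t g)) := by
      conv_lhs => rw [← hG]
      refine Submodule.span_le.2 fun g hg => ?_
      obtain ⟨w, hw⟩ := Finset.dvd_prod_of_mem t hg
      change (∏ g ∈ G, t g) * g = 0
      rw [hw, mul_right_comm, ht0 g (hGI g hg), zero_mul]
    exact hle ha

/-- If `f` annihilates the prime ideal `I` but is not in `I`, then `A_f` is a localization of the
domain `A / I`. -/
theorem isLocalization_away_quotient {A : Type*} [CommRing A] (I : Ideal A) (f : A)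
    [Algebra (A ⧸ I) (Localization.Away f)] [IsScalarTower A (A ⧸ I) (Localization.Away f)] :
    IsLocalization.Away (Ideal.Quotient.mk I f) (Localization.Away f) := by
  have := IsLocalization.of_surjective (Submonoid.powers f) (S := Localization.Away f)
    (S' := Localization.Away f) (Ideal.Quotient.mk I) Ideal.Quotient.mk_surjective
    (RingHom.id _) Function.surjective_id
    (RingHom.ext fun a => IsScalarTower.algebraMap_apply A (A ⧸ I) (Localization.Away f) a)
    (fun x hx => by rw [show x = 0 from hx]; exact zero_mem _)
  rwa [Submonoid.map_powers] at this

end Minimal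

/-! ### Transport of localization properties to `F^e_*`. -/

section Transport

variable (p e : ℕ)

theorem FrobeniusPushforward.isFractionsModNil {D D' : Type*} [CommRing D] [CommRing D']
    [Algebra D D'] (h : IsFractionsModNil D D') :
    letI := FrobeniusPushforward.mapAlgebra p e D D'
    IsFractionsModNil (FrobeniusPushforward p e D) (FrobeniusPushforward p e D') := by
  let _ := FrobeniusPushforward.mapAlgebra p e D D'
  exact ⟨h.surj, h.nil⟩

theorem FrobeniusPushforward.flat_mapAlgebra {D D' : Type*} [CommRing D] [CommRing D']
    [Algebra D D'] (h : Module.Flat D D') :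
    letI := FrobeniusPushforward.mapAlgebra p e D D'
    Module.Flat (FrobeniusPushforward p e D) (FrobeniusPushforward p e D') := by
  let _ := FrobeniusPushforward.mapAlgebra p e D D'
  rw [← RingHom.flat_algebraMap_iff]
  have h1 := RingHom.Flat.of_bijective
    (f := (FrobeniusPushforward.of p e D').toRingHom) (FrobeniusPushforward.of p e D').bijective
  have h2 := RingHom.Flat.of_bijective
    (f := (FrobeniusPushforward.of p e D).symm.toRingHom)
    (FrobeniusPushforward.of p e D).symm.bijective
  exact h2.comp ((RingHom.flat_algebraMap_iff.2 h).comp h1)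

end Transport

/-! ### Assembly of the theorem. -/

/-- One exponent for all minimal primes. -/
theorem exists_uniform_exponent (p : ℕ) [Fact p.Prime] (A : Type u) (R : Type*) [CommRing A]
    [CommRing R] [IsNoetherianRing A] [CharP A p] [Algebra A R] [Algebra.FiniteType A R] :
    ∃ e₀ : ℕ, ∀ e ≥ e₀, ∀ I ∈ minimalPrimes A,
      ∀ (L : Type u) [Field L] [Algebra A L], (∀ a, algebraMap A L a = 0 ↔ a ∈ I) →
        (∀ a : A, ∃ b : L, b ^ p ^ e = algebraMap A L a) →
        nilradical (AlgebraicClosure L ⊗[A] R) ≤ (nilradical (L ⊗[A] R)).map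
          (mapLeft (IsScalarTower.toAlgHom A L (AlgebraicClosure L)) R) := by
  have hex : ∀ I : Ideal A, ∃ e₀ : ℕ, I ∈ minimalPrimes A → ∀ e ≥ e₀,
      ∀ (L : Type u) [Field L] [Algebra A L], (∀ a, algebraMap A L a = 0 ↔ a ∈ I) →
        (∀ a : A, ∃ b : L, b ^ p ^ e = algebraMap A L a) →
        nilradical (AlgebraicClosure L ⊗[A] R) ≤ (nilradical (L ⊗[A] R)).map
          (mapLeft (IsScalarTower.toAlgHom A L (AlgebraicClosure L)) R) := by
    intro I
    by_cases hI : I ∈ minimalPrimes A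
    · have : I.IsPrime := hI.1.1
      obtain ⟨P, _, _, _, _, _, _, e₀, he₀⟩ := exists_exponent p (R := R) I
      exact ⟨e₀, fun _ e he => (he₀ e he).2⟩
    · exact ⟨0, fun h => absurd h hI⟩
  choose E hE using hex
  have hfin : (minimalPrimes A).Finite := minimalPrimes.finite_of_isNoetherianRing A
  refine ⟨hfin.toFinset.sup E, fun e he I hI => hE I hI e ?_⟩
  exact (Finset.le_sup (hfin.mem_toFinset.2 hI)).trans he

/-- The generic fibers of the reduced twist by `F^e_* A` are geometrically reduced. -/
theorem isGeometricallyReduced_fiber (p e : ℕ) [Fact p.Prime] {A : Type u} {R : Type*} [CommRing A]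
    [CommRing R] [CharP A p] [Algebra A R]
    (he : ∀ I ∈ minimalPrimes A,
      ∀ (L : Type u) [Field L] [Algebra A L], (∀ a, algebraMap A L a = 0 ↔ a ∈ I) →
        (∀ a : A, ∃ b : L, b ^ p ^ e = algebraMap A L a) →
        nilradical (AlgebraicClosure L ⊗[A] R) ≤ (nilradical (L ⊗[A] R)).map
          (mapLeft (IsScalarTower.toAlgHom A L (AlgebraicClosure L)) R))
    (J : Ideal (FrobeniusPushforward p e A)) [J.IsPrime]
    (hJ : J ∈ minimalPrimes (FrobeniusPushforward p e A)) :
    Algebra.IsGeometricallyReduced J.ResidueField (J.Fiber (ReducedTwist p e A A R)) := by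
  let φ : A →+* FrobeniusPushforward p e A := (FrobeniusPushforward.of p e A).toRingHom
  have hI : J.comap φ ∈ minimalPrimes A := by
    have := Ideal.minimalPrimes_comap_of_surjective (FrobeniusPushforward.of p e A).surjective
      (f := φ) (I := ⊥) hJ
    rwa [Ideal.comap_bot_of_injective φ (FrobeniusPushforward.of p e A).injective] at this
  refine isGeometricallyReduced_tensorProduct_reduction (A := A) (R := R)
    (IsFractionsModNil.of_minimalPrimes J hJ) (he _ hI J.ResidueField (fun a => ?_) fun a => ?_)
  · rw [IsScalarTower.algebraMap_apply A (FrobeniusPushforward p e A) J.ResidueField,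
      Ideal.algebraMap_residueField_eq_zero, Ideal.mem_comap]
    change φ (a ^ p ^ e) ∈ J ↔ _
    rw [map_pow]
    exact Ideal.IsPrime.pow_mem_iff_mem inferInstance _ (pow_pos (Fact.out : p.Prime).pos e)
  -- The element `a` of the ring underlying `F^e_* A` is the `p ^ e`-th root of the image of `a`
  -- under the structure map.
  · refine ⟨algebraMap _ J.ResidueField (φ a), ?_⟩
    rw [IsScalarTower.algebraMap_apply A (FrobeniusPushforward p e A) J.ResidueField, ← map_pow,
      ← map_pow]
    rfl

/-- The generic fiber of the reduced twist by a domain is geometrically reduced. -/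
theorem isGeometricallyReduced_fractionRing (p e : ℕ) [Fact p.Prime] {A C : Type u} {R : Type*}
    [CommRing A] [CommRing C] [IsDomain C] [CommRing R] [CharP C p] [Algebra A C] [Algebra A R]
    (I : Ideal A) (hI : ∀ a, algebraMap A C a = 0 ↔ a ∈ I)
    (he : ∀ (L : Type u) [Field L] [Algebra A L], (∀ a, algebraMap A L a = 0 ↔ a ∈ I) →
        (∀ a : A, ∃ b : L, b ^ p ^ e = algebraMap A L a) →
        nilradical (AlgebraicClosure L ⊗[A] R) ≤ (nilradical (L ⊗[A] R)).map
          (mapLeft (IsScalarTower.toAlgHom A L (AlgebraicClosure L)) R)) :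
    Algebra.IsGeometricallyReduced (FractionRing (FrobeniusPushforward p e C))
      (FractionRing (FrobeniusPushforward p e C) ⊗[FrobeniusPushforward p e C]
        ReducedTwist p e A C R) := by
  let F := FrobeniusPushforward p e C
  refine isGeometricallyReduced_tensorProduct_reduction (A := A) (R := R)
    (IsFractionsModNil.of_isLocalization (nonZeroDivisors F))
    (he (FractionRing F) (fun a => ?_) fun a => ?_)
  · rw [IsScalarTower.algebraMap_apply A F (FractionRing F),
      map_eq_zero_iff _ (IsFractionRing.injective F (FractionRing F)), ← hI a,
      FrobeniusPushforward.algebraMap_apply, map_eq_zero_iff _ (RingEquiv.injective _),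
      pow_eq_zero_iff (pow_ne_zero e (Fact.out : p.Prime).ne_zero)]
  · refine ⟨algebraMap F (FractionRing F) (FrobeniusPushforward.of p e C (algebraMap A C a)), ?_⟩
    rw [IsScalarTower.algebraMap_apply A F (FractionRing F), ← map_pow, ← map_pow]
    rfl

/-- Over a base change along which `R` becomes flat, the relative Frobenius factors through the
reduction, if its exponent bounds the order of nilpotency over a perfect field. -/
theorem exists_ringHom_reducedTwist (p e : ℕ) [Fact p.Prime] {A C R S P : Type*} [CommRing A]
    [CommRing C] [CommRing R] [CommRing S] [Field P] [CharP C p] [CharP P p] [PerfectRing P p]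
    [Algebra A C] [Algebra A R] [Algebra A S] [Algebra A P] [Nontrivial (P ⊗[A] R)]
    (g : C →ₐ[A] P) (hg : Function.Injective g) [Module.Flat C (C ⊗[A] R)]
    (hnil : ∀ x : P ⊗[A] R, IsNilpotent x → x ^ p ^ e = 0) (u : C →ₐ[A] S) (v : R →ₐ[A] S) :
    ∃ ψ : ReducedTwist p e A C R →+* FrobeniusPushforward p e S, ∀ (c : C) (r : R),
      ψ (Ideal.Quotient.mk _ (FrobeniusPushforward.of p e C c ⊗ₜ[A] r)) =
        FrobeniusPushforward.of p e S (u c * v r ^ p ^ e) := by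
  let _ : Algebra C P := g.toRingHom.toAlgebra
  have : IsScalarTower A C P := IsScalarTower.of_algebraMap_eq fun a => (g.commutes a).symm
  let W : C ⊗[A] R →ₐ[A] P ⊗[A] R := Algebra.TensorProduct.map g (AlgHom.id A R)
  -- `W` is the base change of the injection `C → P` along the flat module `C ⊗ R`.
  have hW : Function.Injective W := fun x y hxy => by
    have h : ∀ z, W z = Algebra.TensorProduct.cancelBaseChange A C P P R (1 ⊗ₜ z) := fun z =>
      mapLeft_toAlgHom_apply A C P z
    rw [h, h] at hxy
    exact Algebra.TensorProduct.includeRight_injective (A := P) hg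
      ((Algebra.TensorProduct.cancelBaseChange A C P P R).injective hxy)
  have : Nontrivial (C ⊗[A] R) := W.toRingHom.domain_nontrivial
  have : CharP (C ⊗[A] R) p := CharP.of_ringHom_of_prime p (algebraMap C (C ⊗[A] R))
  let F : FrobeniusPushforward p e C ⊗[A] R →ₐ[A] FrobeniusPushforward p e (C ⊗[A] R) :=
    relativeFrobenius p e Algebra.TensorProduct.includeLeft Algebra.TensorProduct.includeRight
  -- Nilpotents already die in `F^e_* (C ⊗ R)`, so any map from there to `S` may follow.
  let m : C ⊗[A] R →ₐ[A] S := Algebra.TensorProduct.lift u v fun _ _ => Commute.all _ _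
  let θ : FrobeniusPushforward p e C ⊗[A] R →+* FrobeniusPushforward p e S :=
    (FrobeniusPushforward.of p e S).toRingHom.comp (m.toRingHom.comp
      ((FrobeniusPushforward.of p e (C ⊗[A] R)).symm.toRingHom.comp F.toRingHom))
  have hF : ∀ n, IsNilpotent n → F n = 0 := fun n hn =>
    relativeFrobenius_eq_zero p e _ _ g W hW
      (fun c => (Algebra.TensorProduct.map_tmul _ _ _ _).trans (by rw [map_one]))
      (fun r => (Algebra.TensorProduct.map_tmul _ _ _ _).trans (by rw [map_one]; rfl)) hnil hn
  refine ⟨Ideal.Quotient.lift _ θ fun n hn => ?_, fun c r => ?_⟩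
  · change FrobeniusPushforward.of p e S (m ((FrobeniusPushforward.of p e _).symm (F n))) = 0
    rw [hF n hn, map_zero, map_zero, map_zero]
  · rw [Ideal.Quotient.lift_mk]
    change FrobeniusPushforward.of p e S (m ((FrobeniusPushforward.of p e _).symm
      (relativeFrobenius p e _ _ _))) = _
    rw [relativeFrobenius_tmul, RingEquiv.symm_apply_apply, map_mul, map_pow]
    exact congr_arg _ (congr_arg₂ _
      ((Algebra.TensorProduct.lift_tmul _ _ _ _ _).trans (by rw [map_one, mul_one]))
      (congr_arg (· ^ p ^ e)
        ((Algebra.TensorProduct.lift_tmul _ _ _ _ _).trans (by rw [map_one, one_mul]))))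

theorem nontrivial_tensorProduct_of_fiber {A R P : Type*} [CommRing A] [CommRing R] [Field P]
    [Algebra A R] [Algebra A P] (I : Ideal A) [I.IsPrime] [Nontrivial (I.Fiber R)]
    (κ : I.ResidueField →ₐ[A] P) : Nontrivial (P ⊗[A] R) := by
  let _ : Algebra I.ResidueField P := κ.toRingHom.toAlgebra
  have : IsScalarTower A I.ResidueField P :=
    IsScalarTower.of_algebraMap_eq fun a => (κ.commutes a).symm
  have h : Function.Injective (Algebra.TensorProduct.includeRight :
      I.Fiber R →ₐ[I.ResidueField] P ⊗[I.ResidueField] I.Fiber R) :=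
    Algebra.TensorProduct.includeRight_injective κ.toRingHom.injective
  have := h.nontrivial
  exact (Algebra.TensorProduct.cancelBaseChange A I.ResidueField P P R).injective.nontrivial

/-- Let `f` annihilate the prime ideal `I` of `A`, and let `f` be not in `I`. Then `A_f` is an
algebra over the domain `A / I`. -/
theorem exists_algebra_quotient_away {A : Type*} [CommRing A] (I : Ideal A) (f : A)
    (hf : ∀ a ∈ I, f * a = 0) :
    ∃ _ : Algebra (A ⧸ I) (Localization.Away f),
      IsScalarTower A (A ⧸ I) (Localization.Away f) := by
  let _ : Algebra (A ⧸ I) (Localization.Away f) :=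
    (Ideal.Quotient.lift I (algebraMap A (Localization.Away f)) fun a ha =>
      (IsLocalization.map_eq_zero_iff (Submonoid.powers f) _ a).2
        ⟨⟨f, Submonoid.mem_powers f⟩, hf a ha⟩).toAlgebra
  exact ⟨inferInstance, IsScalarTower.of_algebraMap_eq fun a => rfl⟩

/-- Generic freeness over `F^e_* D` gives a free module over `F^e_* C`. Faithfulness then only needs
it to be non-zero, which follows from the map to `P ⊗ R` that extracts roots. -/
theorem faithfullyFlat_reducedTwist (p e : ℕ) [Fact p.Prime] {A D R P : Type*} {C : Type v} [CommRing A]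
    [CommRing D] [CommRing C] [CommRing R] [Field P] [CharP D p] [CharP C p] [CharP P p]
    [PerfectRing P p] [Algebra A D] [Algebra D C] [Algebra A C] [IsScalarTower A D C] [Algebra A R]
    [Algebra A P] [Nontrivial (P ⊗[A] R)] (g : C →ₐ[A] P) [Module.Flat D C]
    (hDC : IsFractionsModNil D C) (h : D) (hu : IsUnit (algebraMap D C h))
    (hfree : ∀ (B : Type v) [CommRing B] [Algebra (FrobeniusPushforward p e D) B] [Algebra A B]
      [IsScalarTower A (FrobeniusPushforward p e D) B] [Module.Flat (FrobeniusPushforward p e D) B],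
      IsFractionsModNil (FrobeniusPushforward p e D) B →
      IsUnit (algebraMap (FrobeniusPushforward p e D) B (FrobeniusPushforward.of p e D h)) →
      Module.Free B (Reduction (B ⊗[A] R))) :
    Module.FaithfullyFlat (FrobeniusPushforward p e C) (ReducedTwist p e A C R) := by
  let _ := FrobeniusPushforward.mapAlgebra p e D C
  have : IsScalarTower A (FrobeniusPushforward p e D) (FrobeniusPushforward p e C) :=
    IsScalarTower.of_algebraMap_eq fun a => by
      change algebraMap A C a ^ p ^ e = algebraMap D C (algebraMap A D a ^ p ^ e)
      rw [map_pow, ← IsScalarTower.algebraMap_apply]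
  have : Module.Flat (FrobeniusPushforward p e D) (FrobeniusPushforward p e C) :=
    FrobeniusPushforward.flat_mapAlgebra p e inferInstance
  have : Module.Free (FrobeniusPushforward p e C) (ReducedTwist p e A C R) :=
    hfree _ (FrobeniusPushforward.isFractionsModNil p e hDC) hu
  let j : FrobeniusPushforward p e C ⊗[A] R →ₐ[A] P ⊗[A] R :=
    Algebra.TensorProduct.map (FrobeniusPushforward.root p e g) (AlgHom.id A R)
  have : Nontrivial (FrobeniusPushforward p e C ⊗[A] R) := j.toRingHom.domain_nontrivial
  have : Nontrivial (ReducedTwist p e A C R) := by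
    refine Ideal.Quotient.nontrivial_iff.2 fun h => ?_
    exact not_isNilpotent_one (mem_nilradical.1 ((Ideal.eq_top_iff_one _).1 h))
  infer_instance

theorem mainTheorem7 {p : ℕ} [Fact p.Prime] {A R : Type*} [CommRing A] [CommRing R]
    [IsNoetherianRing A] [CharP A p] [CharP R p] [Algebra A R] [Algebra.FiniteType A R]
    (hA : IsFFinite p A) (hR : IsFFinite p R)
    (hreg : (regularLocus A).Nonempty)
    (hequi : ∀ x : PrimeSpectrum A, x.asIdeal ∈ minimalPrimes A →
      IsEquidimensional (x.asIdeal.Fiber R))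
    (hne : ∃ x ∈ regularLocus A, x.asIdeal ∈ minimalPrimes A ∧
      Nontrivial (x.asIdeal.Fiber R)) :
    ∃ (f : A) (e₀ : ℕ) (_ : CharP (Localization.Away f) p)
      (_ : IsDomain (Localization.Away f)),
      0 < e₀ ∧
      -- `A_f` is a regular domain
      IsRegularRing (Localization.Away f) ∧
      -- faithful flatness over `A_f^{1/p^e₀}`
      Module.FaithfullyFlat (FrobeniusPushforward p e₀ (Localization.Away f))
        (ReducedTwist p e₀ A (Localization.Away f) R) ∧
      -- the generic fiber over `A_f^{1/p^e₀}` is geometrically reduced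
      Algebra.IsGeometricallyReduced
        (FractionRing (FrobeniusPushforward p e₀ (Localization.Away f)))
        (FractionRing (FrobeniusPushforward p e₀ (Localization.Away f))
          ⊗[FrobeniusPushforward p e₀ (Localization.Away f)]
            ReducedTwist p e₀ A (Localization.Away f) R) ∧
      -- the generic fibers over `A^{1/p^e₀}` are geometrically reduced
      (∀ x : PrimeSpectrum (FrobeniusPushforward p e₀ A),
        x.asIdeal ∈ minimalPrimes (FrobeniusPushforward p e₀ A) →
        Algebra.IsGeometricallyReduced x.asIdeal.ResidueField
          (x.asIdeal.Fiber (ReducedTwist p e₀ A A R))) ∧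
      -- the relative Frobenius `a ⊗ r ↦ φ_f(a) r ^ p ^ e₀` factors through the reduction, which
      -- makes `F^e₀_* (R_f)` an algebra over it
      ∃ ψ : ReducedTwist p e₀ A (Localization.Away f) R →+*
          FrobeniusPushforward p e₀ (Localization.Away (algebraMap A R f)),
        ∀ (a : Localization.Away f) (r : R),
          ψ (Ideal.Quotient.mk _ (FrobeniusPushforward.of p e₀ (Localization.Away f) a ⊗ₜ[A] r)) =
            FrobeniusPushforward.of p e₀ (Localization.Away (algebraMap A R f))
              (Localization.awayMap (algebraMap A R) f a * algebraMap R _ r ^ p ^ e₀) := by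
  obtain ⟨⟨I, hIp⟩, hIreg, hmin, hnt⟩ := hne
  change I ∈ minimalPrimes A at hmin
  change Nontrivial (I.Fiber R) at hnt
  obtain ⟨s, hs, hsI⟩ := exists_mul_eq_zero_of_regular I hmin hIreg
  have : CharP (A ⧸ I) p := CharP.of_ringHom_of_prime p (Ideal.Quotient.mk I)
  have hD : (frobenius (A ⧸ I) p).Finite := by
    have h1 : ((frobenius (A ⧸ I) p).comp (Ideal.Quotient.mk I)).Finite := by
      rw [show (frobenius (A ⧸ I) p).comp (Ideal.Quotient.mk I) =
        (Ideal.Quotient.mk I).comp (frobenius A p) from RingHom.ext fun a => by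
          simp [frobenius_def]]
      exact (RingHom.Finite.of_surjective _ Ideal.Quotient.mk_surjective).comp hA
    exact RingHom.Finite.of_comp_finite h1
  obtain ⟨P, _, _, _, _, hP, ⟨κ⟩, e₁, he₁⟩ := exists_exponent p (R := R) I
  obtain ⟨e₂, he₂⟩ := exists_uniform_exponent p A R
  -- The successor makes the exponent positive. It must be fixed now, since the element inverted for
  -- the reduced twist depends on `F^e_*`.
  let e := max e₁ e₂ + 1
  have hPR : Nontrivial (P ⊗[A] R) := nontrivial_tensorProduct_of_fiber I κ
  obtain ⟨h₁, hh₁, H₁⟩ := exists_forall_isRegularRing p hD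
  obtain ⟨h₂, hh₂, H₂⟩ := exists_forall_free_tensorProduct' (A := A) (R := R) (D := A ⧸ I)
  obtain ⟨h₃, hh₃, H₃⟩ := exists_forall_free_reduction (A := A) (R := R)
    (B := FrobeniusPushforward p e (A ⧸ I))
  obtain ⟨h₃, rfl⟩ := (FrobeniusPushforward.of p e (A ⧸ I)).surjective h₃
  obtain ⟨a₁, rfl⟩ := Ideal.Quotient.mk_surjective h₁
  obtain ⟨a₂, rfl⟩ := Ideal.Quotient.mk_surjective h₂
  obtain ⟨a₃, rfl⟩ := Ideal.Quotient.mk_surjective h₃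
  rw [Ne, Ideal.Quotient.eq_zero_iff_mem] at hh₁ hh₂
  rw [Ne, map_eq_zero_iff _ (RingEquiv.injective _), Ideal.Quotient.eq_zero_iff_mem] at hh₃
  -- The factors serve in turn to make `A_f` a localization of `A / I`, to make it regular, to make
  -- `R` flat over it, and to make the reduced twist free.
  let f := s * a₁ * a₂ * a₃
  have hfI : f ∉ I := fun h => by
    rcases hIp.mem_or_mem h with h | h
    · rcases hIp.mem_or_mem h with h | h
      · exact (hIp.mem_or_mem h).elim hs hh₁
      · exact hh₂ h
    · exact hh₃ h
  have hf0 : ∀ a ∈ I, f * a = 0 := fun a ha => by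
    rw [show f * a = s * a * (a₁ * a₂ * a₃) by ring, hsI a ha, zero_mul]
  let C := Localization.Away f
  obtain ⟨_, _⟩ := exists_algebra_quotient_away I f hf0
  have hloc : IsLocalization.Away (Ideal.Quotient.mk I f) C := isLocalization_away_quotient I f
  have hle : Submonoid.powers (Ideal.Quotient.mk I f) ≤ nonZeroDivisors (A ⧸ I) :=
    powers_le_nonZeroDivisors_of_noZeroDivisors fun h =>
      hfI (Ideal.Quotient.eq_zero_iff_mem.1 h)
  have hinj : Function.Injective (algebraMap (A ⧸ I) C) := IsLocalization.injective C hle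
  have hdom : IsDomain C := IsLocalization.isDomain_of_le_nonZeroDivisors C hle
  have hchar : CharP C p := CharP.of_ringHom_of_prime p (algebraMap A C)
  have : Module.Flat (A ⧸ I) C := IsLocalization.flat C (Submonoid.powers (Ideal.Quotient.mk I f))
  have : IsNoetherianRing C := IsLocalization.isNoetherianRing (Submonoid.powers f) C inferInstance
  have hDC : IsFractionsModNil (A ⧸ I) C :=
    IsFractionsModNil.of_isLocalization (Submonoid.powers (Ideal.Quotient.mk I f))
  have hunit : ∀ a, a ∣ f → IsUnit (algebraMap (A ⧸ I) C (Ideal.Quotient.mk I a)) := fun a ha =>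
    isUnit_of_dvd_unit (map_dvd _ (map_dvd _ ha))
      (IsLocalization.Away.algebraMap_isUnit (S := C) (Ideal.Quotient.mk I f))
  have hd₁ : a₁ ∣ f := ⟨s * a₂ * a₃, by ring⟩
  have hd₂ : a₂ ∣ f := ⟨s * a₁ * a₃, by ring⟩
  have hd₃ : a₃ ∣ f := ⟨s * a₁ * a₂, by ring⟩
  have hAC : ∀ a, algebraMap A C a = 0 ↔ a ∈ I := fun a => by
    rw [IsScalarTower.algebraMap_apply A (A ⧸ I) C, map_eq_zero_iff _ hinj]
    exact Ideal.Quotient.eq_zero_iff_mem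
  have hfP : IsUnit (algebraMap A P f) := isUnit_iff_ne_zero.2 fun h => hfI ((hP f).1 h)
  -- `A_f` embeds into the perfect closure of `κ(I)`, because `f ∉ I` and the kernel of `A → P` is
  -- `I`.
  let g : C →ₐ[A] P :=
    { IsLocalization.Away.lift (S := C) f hfP with
      commutes' := fun a => IsLocalization.Away.lift_eq f hfP a }
  have hg : Function.Injective g := by
    refine (injective_iff_map_eq_zero g).2 fun c hc => ?_
    obtain ⟨⟨a, t⟩, hat⟩ := IsLocalization.surj (Submonoid.powers f) c
    have h1 : algebraMap A P a = 0 := by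
      rw [← g.commutes a]
      exact (congr_arg g hat).symm.trans (by rw [map_mul, hc, zero_mul])
    rw [(hAC a).2 ((hP a).1 h1)] at hat
    exact (IsLocalization.map_units C t).mul_left_eq_zero.1 hat
  have : Module.Free C (C ⊗[A] R) := H₂ C (hunit a₂ hd₂)
  refine ⟨f, e, hchar, hdom, Nat.succ_pos _, H₁ C hinj hDC (hunit a₁ hd₁),
    faithfullyFlat_reducedTwist p e g hDC _ (hunit a₃ hd₃) H₃,
    isGeometricallyReduced_fractionRing p e I hAC
      (he₁ e ((le_max_left _ _).trans (Nat.le_succ _))).2,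
    fun y hy => isGeometricallyReduced_fiber p e
      (he₂ e ((le_max_right _ _).trans (Nat.le_succ _))) y.asIdeal hy, ?_⟩
  let u : C →ₐ[A] Localization.Away (algebraMap A R f) :=
    { Localization.awayMap (algebraMap A R) f with
      commutes' := fun a => IsLocalization.Away.lift_eq f
        (IsLocalization.Away.algebraMap_isUnit (algebraMap A R f)) a }
  have hnil := (he₁ e ((le_max_left _ _).trans (Nat.le_succ _))).1
  exact exists_ringHom_reducedTwist p e g hg hnil u
    (IsScalarTower.toAlgHom A R (Localization.Away (algebraMap A R f)))
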